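/- For an integer $b>1$ and non-negative integers $h(0),\dots,h(b-1)$ with $h(0)=0$, $h(1)=1$, let $H$ be the map that sends a positive integer $n=\sum_{i=0}^{k}a_ib^i$ (base-$b$ digits $a_i$) to $H(n)=\sum_{i=0}^{k}h(a_i)$. A cycle of $H$ is the orbit $\{H^k(x):k\ge 0\}$ of a positive integer $x$ that is periodic under $H$. A positive integer $n$ is of type $C$ if $H^k(n)\in C$ for some $k\ge 0$. For a set $S$ of positive integers let $\overline d(S)=\limsup_{N\to\infty}|S\cap[1,N]|/N$ and $\underline d(S)=\liminf_{N\to\infty}|S\cap[1,N]|/N$; $S$ has asymptotic density $d$ if $|S\cap[1,N]|/N\to d$. Write $\overline d_C$ and $\underline d_C$ for the upper and lower density of the set of type-$C$ integers. (1) Let $b=10$ and $h(d)=d^3$ (sum of the cubes of the decimal digits). The cycles of $H$ are exactly the nine sets $\{1\}$, $\{55,250,133\}$, $\{136,244\}$, $\{153\}$, $\{160,217,352\}$, $\{370\}$, $\{371\}$, $\{407\}$, $\{919,1459\}$, and the following bounds hold. - $C=\{1\}$: $\overline d_C>0.028219$ and $\underline d_C<0.0049761$. - $C=\{55,250,133\}$: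 $\overline d_C>0.06029$ and $\underline d_C<0.0447701$. - $C=\{136,244\}$: $\overline d_C>0.024909$ and $\underline d_C<0.006398$. - $C=\{160,217,352\}$: $\overline d_C>0.050917$ and $\underline d_C<0.03184$. - $C=\{370\}$: $\overline d_C>0.19905$ and $\underline d_C<0.16065$. - $C=\{371\}$: $\overline d_C>0.30189$ and $\underline d_C<0.288001$. - $C=\{407\}$: $\overline d_C>0.04532$ and $\underline d_C<0.0314401$. - $C=\{919,1459\}$: $\overline d_C>0.04425$ and $\underline d_C<0.01843$. For each of these eight cycles $C$ the set of type-$C$ integers has no asymptotic density. For $C=\{153\}$, $\overline d_C=\underline d_C=\tfrac13$, so the set of type-$\{153\}$ integers has asymptotic density exactly $\tfrac13$. (2) Let $b=7$ and $(h(0),\dots,h(6))=(0,1,7,4,17,9,13)$. The cycles of $H$ are exactly $\{1\}$ and $\{20\}$ (written in base 10). For $C=\{1\}$, $\overline d_C>0.9858$ and $\underline d_C<0.94222$, and the set of type-$\{1\}$ integers has no asymptotic density. -/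

import Mathlib

namespace HappyNumbers

/-- The generalized `b`-happy function with digit sequence `h` (only the values `h 0, …, h (b - 1)`
matter): it sends `n` with base `b` digits `a₀, …, a_k` to `h a₀ + ⋯ + h a_k`. -/
def happyMap (b : ℕ) (h : ℕ → ℕ) (n : ℕ) : ℕ :=
  ((Nat.digits b n).map h).sum

/-- The sum of the cubes of the decimal digits:
base 10, digit sequence `0, 1, 8, 27, 64, 125, 216, 343, 512, 729`. -/
def cubeMap : ℕ → ℕ := happyMap 10 (fun d => d ^ 3)

/-- The generalized 7-happy function with digit sequence `0, 1, 7, 4, 17, 9, 13`. -/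
def baseSevenMap : ℕ → ℕ := happyMap 7 (fun d => [0, 1, 7, 4, 17, 9, 13].getD d 0)

/-- The type-`C` positive integers: those whose trajectory under `H` meets `C`. -/
def typeSet (H : ℕ → ℕ) (C : Set ℕ) : Set ℕ :=
  {n | 0 < n ∧ ∃ k : ℕ, H^[k] n ∈ C}

/-- The cycles of `H` on the positive integers, as sets: the orbits of positive periodic points. -/
def cycles (H : ℕ → ℕ) : Set (Set ℕ) :=
  {C | ∃ x : ℕ, 0 < x ∧ x ∈ Function.periodicPts H ∧ C = {y | ∃ k : ℕ, H^[k] x = y}}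

/-- The proportion of the integers in `[1, N]` that belong to `S`. -/
noncomputable def relDensity (S : Set ℕ) (N : ℕ) : ℝ :=
  ((S ∩ Set.Icc 1 N).ncard : ℝ) / (N : ℝ)

/-- The upper (asymptotic) density. -/
noncomputable def upperDensity (S : Set ℕ) : ℝ :=
  Filter.limsup (relDensity S) Filter.atTop

/-- The lower (asymptotic) density. -/
noncomputable def lowerDensity (S : Set ℕ) : ℝ :=
  Filter.liminf (relDensity S) Filter.atTop

/-- `S` has asymptotic density `d`. -/
def HasDensity (S : Set ℕ) (d : ℝ) : Prop :=
  Filter.Tendsto (relDensity S) Filter.atTop (nhds d)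

end HappyNumbers

/-!
Let `H` be `happyMap b h`, and let `S` be a set of integers with `H x ∈ S ↔ x ∈ S`: a type set, or
the complement of one. The proportion of `S` in `[0, b ^ n)` is the probability that `H_n ∈ S`, where
`H_n` is the sum of `h` over `n` independent random digits. So it is a weighted count of the elements
of `S` near the mean of `H_n`, which is `μ * n`.

*Propagation of a density.* Let `S` have proportion `d` in `[0, X)`, where `X = b ^ n`. The random walk
`H_0, H_1, …` needs about `M = X / μ` steps to cross `[0, X)`, and the mean of `#(S ∩ [0, H_M))`
telescopes into expected numbers of visits to `S` in `M` steps of the walks started at the points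
`i < h d` (`avg_sum_range`). The starting point matters only by a bounded amount, by a coupling of
renewal type (`abs_visits_sub_visits_le`), and `H_M` deviates from `X` by `O(√X)`, by its variance. So
the average over `m < M` of the proportion of `S` in `[0, b ^ m)` is at least `d - O(1 / √X)`, and some
`m > n` has a proportion as large as that (`exists_avg_ge`). Iterating, the errors decrease at least
geometrically, hence the upper density of `S` is at least `d` minus twice the first error
(`frequently_avg_ge`). Applied to the complement of a type set this bounds the lower density from
above.

*Initial densities.* It remains to bound the proportion of `S` in `[0, b ^ n)` for suitable `n`, up to
`2739`, and this is done by kernel computation. The distribution of `H_n` is the `n`-th power of the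
polynomial `∑ X ^ h d`, which is packed into a single natural number and computed by repeated squaring
with downward rounding (`slotsBelow_packedPow`); `S` becomes a bit mask on the coefficients, built
recursively from the leading digits down (`mask`). As coefficients are only rounded down or dropped,
the result is a lower bound (`maskedSum_le`).

The cycles are found by checking the integers below a bound above which `H n < n`. The sum of the cubes
of the digits of `n` is congruent to `n` modulo `3`, and `{153}` is the only cycle of multiples of `3`;
so its type set consists of the positive multiples of `3`.
-/

namespace HappyNumbers

open Polynomial Finset Filter Topology

/-! ### Digits and the map `happyMap` -/

section Digits

variable {b : ℕ} {h : ℕ → ℕ}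

@[simp]
theorem happyMap_zero (b : ℕ) (h : ℕ → ℕ) : happyMap b h 0 = 0 := by
  simp [happyMap]

theorem happyMap_eq (hb : 1 < b) (h0 : h 0 = 0) (n : ℕ) :
    happyMap b h n = h (n % b) + happyMap b h (n / b) := by
  rcases Nat.eq_zero_or_pos n with rfl | hn
  · simp [h0]
  · conv_lhs => rw [happyMap, Nat.digits_def' hb hn]
    simp [happyMap]

theorem happyMap_add_mul (hb : 1 < b) (h0 : h 0 = 0) {d : ℕ} (hd : d < b) (n : ℕ) :
    happyMap b h (d + b * n) = h d + happyMap b h n := by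
  rw [happyMap_eq hb h0, Nat.add_mul_mod_self_left, Nat.mod_eq_of_lt hd,
    Nat.add_mul_div_left _ _ (by omega), Nat.div_eq_of_lt hd, zero_add]

theorem happyMap_of_lt (hb : 1 < b) (h0 : h 0 = 0) {d : ℕ} (hd : d < b) :
    happyMap b h d = h d := by
  simpa using happyMap_add_mul hb h0 hd 0

theorem happyMap_pow_mul_add (hb : 1 < b) (h0 : h 0 = 0) (k y : ℕ) {j : ℕ} (hj : j < b ^ k) :
    happyMap b h (b ^ k * y + j) = happyMap b h y + happyMap b h j := by
  induction k generalizing j with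
  | zero =>
    obtain rfl : j = 0 := by simpa using hj
    simp
  | succ k ih =>
    have hb0 : 0 < b := by omega
    have hj' : j / b < b ^ k := by
      rw [Nat.div_lt_iff_lt_mul hb0]; rwa [pow_succ] at hj
    have e : b ^ (k + 1) * y + j = j % b + b * (b ^ k * y + j / b) := by
      conv_lhs => rw [← Nat.mod_add_div j b]
      ring
    rw [e, happyMap_add_mul hb h0 (Nat.mod_lt _ hb0), ih hj', happyMap_eq hb h0 j]
    ring

theorem happyMap_pos (hb : 1 < b) (h0 : h 0 = 0) (hpos : ∀ d, 0 < d → d < b → 0 < h d)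
    {n : ℕ} (hn : 0 < n) : 0 < happyMap b h n := by
  induction n using Nat.strong_induction_on with
  | _ n ih =>
    rw [happyMap_eq hb h0]
    rcases Nat.eq_zero_or_pos (n % b) with hm | hm
    · have : 0 < n / b := Nat.div_pos (Nat.le_of_dvd hn (Nat.dvd_of_mod_eq_zero hm)) (by omega)
      have := ih _ (Nat.div_lt_self hn hb) this
      omega
    · have := hpos _ hm (Nat.mod_lt _ (by omega))
      omega

theorem sum_range_mul {M : Type*} [AddCommMonoid M] (b m : ℕ) (F : ℕ → M) :
    ∑ x ∈ range (b * m), F x = ∑ y ∈ range m, ∑ d ∈ range b, F (b * y + d) := by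
  induction m with
  | zero => simp
  | succ m ih => rw [mul_add, mul_one, Finset.sum_range_add, ih, Finset.sum_range_succ]

/-- Splitting off the last digit. -/
theorem sum_range_pow_succ {M : Type*} [AddCommMonoid M] (hb : 1 < b) (h0 : h 0 = 0) (n : ℕ)
    (F : ℕ → M) :
    ∑ x ∈ range (b ^ (n + 1)), F (happyMap b h x) =
      ∑ y ∈ range (b ^ n), ∑ d ∈ range b, F (h d + happyMap b h y) := by
  rw [pow_succ', sum_range_mul]
  refine Finset.sum_congr rfl fun y _ => Finset.sum_congr rfl fun d hd => ?_
  rw [add_comm, happyMap_add_mul hb h0 (Finset.mem_range.1 hd)]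

end Digits

/-! ### The generating polynomial of the digit sums -/

section GeneratingPolynomial

variable {b : ℕ} {h : ℕ → ℕ}

/-- The generating polynomial `∑ X ^ h d` of one digit. The coefficient of `X ^ x` in its `n`-th
power counts the `y < b ^ n` with `happyMap b h y = x`. -/
noncomputable def digitPoly (b : ℕ) (h : ℕ → ℕ) : ℕ[X] :=
  ∑ d ∈ range b, X ^ h d

theorem digitPoly_pow (hb : 1 < b) (h0 : h 0 = 0) (n : ℕ) :
    digitPoly b h ^ n = ∑ y ∈ range (b ^ n), X ^ happyMap b h y := by
  induction n with
  | zero => simp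
  | succ n ih =>
    rw [pow_succ, ih, sum_range_pow_succ hb h0 n (fun x => (X : ℕ[X]) ^ x), digitPoly,
      Finset.sum_mul]
    refine Finset.sum_congr rfl fun y _ => ?_
    rw [Finset.mul_sum]
    exact Finset.sum_congr rfl fun d _ => by rw [pow_add, mul_comm]

theorem coeff_digitPoly_pow (hb : 1 < b) (h0 : h 0 = 0) (n x : ℕ) :
    (digitPoly b h ^ n).coeff x = ∑ y ∈ range (b ^ n), if happyMap b h y = x then 1 else 0 := by
  rw [digitPoly_pow hb h0, Polynomial.finsetSum_coeff]
  exact Finset.sum_congr rfl fun y _ => by rw [coeff_X_pow]; simp only [eq_comm]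

theorem coeff_digitPoly_pow_le (hb : 1 < b) (h0 : h 0 = 0) (n x : ℕ) :
    (digitPoly b h ^ n).coeff x ≤ b ^ n := by
  rw [coeff_digitPoly_pow hb h0]
  calc _ ≤ ∑ y ∈ range (b ^ n), 1 := Finset.sum_le_sum fun y _ => by split_ifs <;> simp
    _ = b ^ n := by simp

end GeneratingPolynomial

/-! ### Packed polynomials -/

section Slots

/-- The `i`-th digit of `N` in base `2 ^ w`. A polynomial with coefficients below `2 ^ w` is packed
into the number whose slots are its coefficients. -/
def slot (w N i : ℕ) : ℕ :=
  (N >>> (w * i)) % 2 ^ w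

theorem slot_zero (w N : ℕ) : slot w N 0 = N % 2 ^ w := by simp [slot]

theorem slot_succ (w N i : ℕ) : slot w N (i + 1) = slot w (N / 2 ^ w) i := by
  rw [slot, slot, Nat.shiftRight_eq_div_pow, Nat.shiftRight_eq_div_pow, Nat.div_div_eq_div_mul,
    ← pow_add]
  congr 3
  ring

theorem slot_eval {w : ℕ} (q : ℕ[X]) (hq : ∀ i, q.coeff i < 2 ^ w) (i : ℕ) :
    slot w (q.eval (2 ^ w)) i = q.coeff i := by
  have key : ∀ q : ℕ[X], q.eval (2 ^ w) = q.coeff 0 + 2 ^ w * q.divX.eval (2 ^ w) := fun q => by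
    conv_lhs => rw [← divX_mul_X_add q]
    simp [mul_comm, add_comm]
  induction i generalizing q with
  | zero => rw [slot_zero, key, Nat.add_mul_mod_self_left, Nat.mod_eq_of_lt (hq 0)]
  | succ i ih =>
    rw [slot_succ, key, Nat.add_mul_div_left _ _ (by positivity), Nat.div_eq_of_lt (hq 0), zero_add,
      ih q.divX fun j => by rw [coeff_divX]; exact hq _, coeff_divX]

theorem exists_eval_eq {w : ℕ} (hw : 0 < w) (N : ℕ) :
    ∃ q : ℕ[X], q.eval (2 ^ w) = N ∧ ∀ i, q.coeff i = slot w N i := by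
  induction N using Nat.strong_induction_on with
  | _ N ih =>
    rcases Nat.eq_zero_or_pos N with rfl | hN
    · exact ⟨0, by simp [slot]⟩
    · obtain ⟨q, hq, hc⟩ := ih (N / 2 ^ w) (Nat.div_lt_self hN (Nat.one_lt_two_pow hw.ne'))
      refine ⟨q * X + C (N % 2 ^ w), ?_, ?_⟩
      · simp only [eval_add, eval_mul, eval_X, eval_C, hq]
        exact Nat.div_add_mod' N (2 ^ w)
      · rintro (_ | i)
        · simp [slot_zero]
        · rw [slot_succ, ← hc]
          simp

theorem slot_sum {w : ℕ} (L : ℕ) (f : ℕ → ℕ) (hf : ∀ i, f i < 2 ^ w) (j : ℕ) :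
    slot w (∑ i ∈ range L, f i * (2 ^ w) ^ i) j = if j < L then f j else 0 := by
  have hc : ∀ j, (∑ i ∈ range L, C (f i) * X ^ i : ℕ[X]).coeff j = if j < L then f j else 0 := by
    intro j
    simp [coeff_X_pow]
  have := slot_eval (w := w) (∑ i ∈ range L, C (f i) * X ^ i) (fun i => by
    rw [hc]; split_ifs
    · exact hf i
    · positivity) j
  rw [hc] at this
  rw [← this]
  congr 1
  simp [eval_finsetSum]

theorem slot_land (w M N i : ℕ) : slot w (M &&& N) i = slot w M i &&& slot w N i := by
  rw [slot, slot, slot, Nat.shiftRight_and_distrib, Nat.and_mod_two_pow]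

theorem slot_shiftRight (w N k i : ℕ) : slot w (N >>> (w * k)) i = slot w N (i + k) := by
  rw [slot, slot, ← Nat.shiftRight_add]
  congr 2
  ring

/-- Since `2 ^ w` is congruent to `1` modulo `2 ^ w - 1`, reduction modulo `2 ^ w - 1` adds up the
slots. -/
theorem mod_le_sum_slot {w : ℕ} (hw : 0 < w) (N : ℕ) :
    ∃ D, N % (2 ^ w - 1) ≤ ∑ i ∈ range D, slot w N i := by
  obtain ⟨q, hq, hc⟩ := exists_eval_eq hw N
  refine ⟨q.natDegree + 1, ?_⟩
  have h1 : 2 ^ w ≡ 1 [MOD 2 ^ w - 1] :=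
    ((Nat.modEq_iff_dvd' Nat.one_le_two_pow).2 dvd_rfl).symm
  have h2 : N ≡ ∑ i ∈ range (q.natDegree + 1), slot w N i [MOD 2 ^ w - 1] := by
    conv_lhs => rw [← hq]
    rw [eval_eq_sum_range]
    simp only [← hc]
    refine Nat.ModEq.sum fun i _ => ?_
    simpa using (h1.pow i).mul_left (q.coeff i)
  rw [h2]
  exact Nat.mod_le _ _

/-- Masking after a shift by `k` bits that is not a multiple of the slot width: the low bits of the
next slot are cut off, so that every slot is divided by `2 ^ k`. -/
theorem slot_floor_le (w N M a k i : ℕ) (hM : slot w M i < 2 ^ (w - k)) :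
    slot w ((N >>> (w * a + k)) &&& M) i ≤ slot w N (i + a) / 2 ^ k := by
  rw [slot_land]
  have h1 : ∀ x, x &&& slot w M i ≤ x % 2 ^ (w - k) := fun x => by
    rw [← Nat.mod_eq_of_lt (Nat.and_lt_two_pow x hM), Nat.and_mod_two_pow]
    exact Nat.and_le_left
  refine (h1 _).trans ?_
  rcases le_or_gt k w with hk | hk
  · have e : slot w (N >>> (w * a + k)) i = ((N >>> (w * (i + a))) / 2 ^ k) % 2 ^ w := by
      rw [slot, ← Nat.shiftRight_eq_div_pow, ← Nat.shiftRight_add, ← Nat.shiftRight_add]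
      congr 2
      ring
    have e2 : 2 ^ w = 2 ^ k * 2 ^ (w - k) := by rw [← pow_add]; congr 1; omega
    rw [e, Nat.mod_mod_of_dvd _ (pow_dvd_pow 2 (Nat.sub_le w k)), slot, e2,
      Nat.mod_mul_right_div_self]
  · rw [Nat.sub_eq_zero_of_le hk.le]
    simp [Nat.mod_one]

end Slots

/-! ### Evaluable versions of the maps and masks -/

section Evaluation

/-- `force n f = f n`. Evaluating it by kernel reduction first turns `n` into a literal, so that
repeated calls with the same argument are found in the cache of the kernel. -/
def force {α : Type} (n : ℕ) (f : ℕ → α) : α :=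
  match n with
  | 0 => f 0
  | m + 1 => f (Nat.succ m)

@[simp]
theorem force_eq {α : Type} (n : ℕ) (f : ℕ → α) : force n f = f n := by
  cases n <;> rfl

/-- `happyMap` by structural recursion on a bound for the number of digits. -/
def fastMap (b : ℕ) (h : ℕ → ℕ) : ℕ → ℕ → ℕ
  | 0, n => happyMap b h n
  | f + 1, n => bif Nat.beq n 0 then 0 else h (n % b) + fastMap b h f (n / b)

/-- Whether the trajectory of `s` meets the list `L` in fewer than `k` steps. -/
def meets (b : ℕ) (h : ℕ → ℕ) (L : List ℕ) : ℕ → ℕ → Bool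
  | 0, _ => false
  | k + 1, s => bif L.any (Nat.beq s) then true
      else force (fastMap b h 10 s) (meets b h L k)

/-- The number with slots of width `w`, indexed by `i < b ^ k`, in which slot `i` is filled with
ones if `t` holds at `s + happyMap b h i`, and is zero otherwise. -/
def mask (b : ℕ) (h : ℕ → ℕ) (t : ℕ → Bool) (w : ℕ) : ℕ → ℕ → ℕ
  | 0, s => bif t s then 2 ^ w - 1 else 0
  | k + 1, s => (List.range b).foldr
      (fun d acc => force (s + h d) (mask b h t w k) + acc <<< (w * b ^ k)) 0

/-- The concatenation of `c` masks with `b ^ k` slots: slot `i` is filled with ones if `t` holds at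
`happyMap b h (b ^ k * y + i)`. -/
def maskRange (b : ℕ) (h : ℕ → ℕ) (t : ℕ → Bool) (w k : ℕ) : ℕ → ℕ → ℕ
  | 0, _ => 0
  | c + 1, y => force (fastMap b h 10 y) (mask b h t w k) +
      maskRange b h t w k c (y + 1) <<< (w * b ^ k)

variable {b : ℕ} {h : ℕ → ℕ}

theorem fastMap_eq (hb : 1 < b) (h0 : h 0 = 0) (f n : ℕ) : fastMap b h f n = happyMap b h n := by
  induction f generalizing n with
  | zero => rfl
  | succ f ih =>
    rw [fastMap]
    rcases Nat.eq_zero_or_pos n with rfl | hn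
    · simp
    · rw [ih, happyMap_eq hb h0 n]
      have : Nat.beq n 0 = false := by
        rw [← Bool.not_eq_true, Nat.beq_eq]
        omega
      simp [this]

theorem exists_iterate_mem_of_meets (hb : 1 < b) (h0 : h 0 = 0) {L : List ℕ} {k s : ℕ}
    (hs : meets b h L k s = true) : ∃ j, (happyMap b h)^[j] s ∈ L := by
  induction k generalizing s with
  | zero => simp [meets] at hs
  | succ k ih =>
    rw [meets] at hs
    rcases hL : L.any (Nat.beq s) with _ | _
    · rw [hL, cond_false, force_eq, fastMap_eq hb h0] at hs
      obtain ⟨j, hj⟩ := ih hs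
      exact ⟨j + 1, hj⟩
    · obtain ⟨x, hx, hxs⟩ := List.any_eq_true.1 hL
      rw [Nat.beq_eq] at hxs
      exact ⟨0, by simpa [hxs] using hx⟩

theorem foldr_range_add_mul (n c : ℕ) (f : ℕ → ℕ) :
    (List.range n).foldr (fun d acc => f d + acc * c) 0 = ∑ d ∈ range n, f d * c ^ d := by
  induction n generalizing f with
  | zero => simp
  | succ n ih =>
    rw [List.range_succ_eq_map, List.foldr_cons, List.foldr_map, ih fun d => f (d + 1),
      Finset.sum_range_succ', Finset.sum_mul, add_comm]
    simp only [pow_succ, pow_zero, mul_one, mul_assoc]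

theorem mask_eq (hb : 1 < b) (h0 : h 0 = 0) (t : ℕ → Bool) (w k s : ℕ) :
    mask b h t w k s =
      ∑ i ∈ range (b ^ k), (bif t (s + happyMap b h i) then 2 ^ w - 1 else 0) * (2 ^ w) ^ i := by
  induction k generalizing s with
  | zero => simp [mask]
  | succ k ih =>
    rw [mask]
    simp only [force_eq, Nat.shiftLeft_eq]
    rw [foldr_range_add_mul, pow_succ, sum_range_mul]
    refine Finset.sum_congr rfl fun d hd => ?_
    rw [ih, Finset.sum_mul]
    refine Finset.sum_congr rfl fun i hi => ?_
    rw [happyMap_pow_mul_add hb h0 k d (Finset.mem_range.1 hi),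
      happyMap_of_lt hb h0 (Finset.mem_range.1 hd), add_assoc, mul_assoc]
    congr 1
    ring

theorem maskRange_eq (hb : 1 < b) (h0 : h 0 = 0) (t : ℕ → Bool) (w k c y : ℕ) :
    maskRange b h t w k c y = ∑ i ∈ range (b ^ k * c),
      (bif t (happyMap b h (b ^ k * y + i)) then 2 ^ w - 1 else 0) * (2 ^ w) ^ i := by
  induction c generalizing y with
  | zero => simp [maskRange]
  | succ c ih =>
    rw [maskRange, force_eq, fastMap_eq hb h0, ih, mask_eq hb h0, Nat.shiftLeft_eq,
      mul_add (b ^ k) c 1, mul_one, add_comm (b ^ k * c), Finset.sum_range_add, Finset.sum_mul]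
    congr 1
    · refine Finset.sum_congr rfl fun i hi => ?_
      rw [happyMap_pow_mul_add hb h0 k y (Finset.mem_range.1 hi)]
    · refine Finset.sum_congr rfl fun i _ => ?_
      rw [mul_add, mul_one, add_assoc, mul_assoc]
      congr 1
      ring

theorem slot_maskRange (hb : 1 < b) (h0 : h 0 = 0) (t : ℕ → Bool) (w k c y i : ℕ)
    (hi : slot w (maskRange b h t w k c y) i ≠ 0) : t (happyMap b h (b ^ k * y + i)) = true := by
  rw [maskRange_eq hb h0, slot_sum] at hi
  · by_contra ht
    rw [Bool.not_eq_true] at ht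
    simp [ht] at hi
  · intro i
    have : 0 < 2 ^ w := by positivity
    cases t (happyMap b h (b ^ k * y + i)) <;> simp

end Evaluation

/-! ### Certified lower bounds for powers of a packed polynomial -/

section PackedPower

/-- A packed polynomial `∑ qᵢ X ^ (i + lo)`, scaled by the factor `2 ^ scale`. -/
structure Packed where
  /-- The exponent that slot `0` stands for. -/
  lo : ℕ
  /-- The binary logarithm of the factor by which all the coefficients have been divided. -/
  scale : ℕ
  /-- The number whose slots are the coefficients. -/
  val : ℕ

/-- The number with `L` slots of width `w`, all equal to `v`. -/
def ones (w v L : ℕ) : ℕ :=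
  v * ((2 ^ (w * L) - 1) / (2 ^ w - 1))

/-- Rounding down: restrict to the `(win n).2` slots from the exponent `(win n).1` on, and divide the
slots by the power of two that leaves about `p` bits of the total mass `b ^ n`. The guard excludes
that a slot has overflowed. -/
def trim (b w p : ℕ) (win : ℕ → ℕ × ℕ) (n : ℕ) (Q : Packed) : Packed :=
  bif Nat.blt (b ^ n) (2 ^ (Q.scale + w)) then
    ⟨Q.lo + ((win n).1 - Q.lo), Q.scale + ((b ^ n).log2 - p - Q.scale),
      (Q.val >>> (w * ((win n).1 - Q.lo) + ((b ^ n).log2 - p - Q.scale))) &&&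
        ones w (2 ^ (w - ((b ^ n).log2 - p - Q.scale)) - 1) (win n).2⟩
  else ⟨0, 0, 0⟩

/-- `digitPoly b h`, packed. -/
def packedDigitPoly (b : ℕ) (h : ℕ → ℕ) (w : ℕ) : ℕ :=
  ((List.range b).map fun d => 2 ^ (w * h d)).sum

/-- A lower approximation to `digitPoly b h ^ n` by repeated squaring, with rounding after each
step. -/
def packedPow (b : ℕ) (h : ℕ → ℕ) (w p : ℕ) (win : ℕ → ℕ × ℕ) : ℕ → ℕ → Packed
  | 0, _ => ⟨0, 0, 0⟩
  | f + 1, n => bif Nat.beq n 0 then ⟨0, 0, 1⟩ else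
    trim b w p win n ⟨2 * (packedPow b h w p win f (n / 2)).lo,
      2 * (packedPow b h w p win f (n / 2)).scale,
      (packedPow b h w p win f (n / 2)).val * (packedPow b h w p win f (n / 2)).val *
       (bif Nat.beq (n % 2) 0 then 1 else packedDigitPoly b h w)⟩

/-- The sum of the coefficients of `Q` at the exponents `x` for which `t` holds at
`happyMap b h x`. -/
def maskedSum (b : ℕ) (h : ℕ → ℕ) (w : ℕ) (t : ℕ → Bool) (k c : ℕ) (Q : Packed) : ℕ :=
  ((Q.val &&& ((maskRange b h t w k c (Q.lo / b ^ k)) >>> (w * (Q.lo % b ^ k)))) % (2 ^ w - 1)) *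
     2 ^ Q.scale

/-- Some polynomial that evaluates to `Q.val` at `2 ^ w` is, after shift and scaling, coefficientwise
at most `digitPoly b h ^ n`. This is stable under multiplication even when slots overflow. -/
def PolyBelow (b : ℕ) (h : ℕ → ℕ) (w n : ℕ) (Q : Packed) : Prop :=
  ∃ q : ℕ[X], q.eval (2 ^ w) = Q.val ∧
    ∀ i, q.coeff i * 2 ^ Q.scale ≤ (digitPoly b h ^ n).coeff (i + Q.lo)

/-- The slots of `Q` are, after shift and scaling, at most the coefficients of
`digitPoly b h ^ n`. -/
def SlotsBelow (b : ℕ) (h : ℕ → ℕ) (w n : ℕ) (Q : Packed) : Prop :=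
  ∀ i, slot w Q.val i * 2 ^ Q.scale ≤ (digitPoly b h ^ n).coeff (i + Q.lo)

variable {b : ℕ} {h : ℕ → ℕ} {w : ℕ}

theorem SlotsBelow.polyBelow (hw : 0 < w) {n : ℕ} {Q : Packed} (hQ : SlotsBelow b h w n Q) :
    PolyBelow b h w n Q := by
  obtain ⟨q, hq, hc⟩ := exists_eval_eq hw Q.val
  exact ⟨q, hq, fun i => by rw [hc]; exact hQ i⟩

theorem slotsBelow_zero (w n : ℕ) : SlotsBelow b h w n ⟨0, 0, 0⟩ := fun i => by
  simp [slot]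

theorem PolyBelow.mul {m n : ℕ} {Q R : Packed} (hQ : PolyBelow b h w m Q)
    (hR : PolyBelow b h w n R) :
    PolyBelow b h w (m + n) ⟨Q.lo + R.lo, Q.scale + R.scale, Q.val * R.val⟩ := by
  obtain ⟨q, hq, hqc⟩ := hQ
  obtain ⟨r, hr, hrc⟩ := hR
  refine ⟨q * r, by simp [hq, hr], fun i => ?_⟩
  have shift : ∀ {p P : ℕ[X]} {s l : ℕ}, (∀ i, p.coeff i * s ≤ P.coeff (i + l)) →
      ∀ i, (p * X ^ l).coeff i * s ≤ P.coeff i := by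
    intro p P s l H i
    rw [coeff_mul_X_pow']
    split_ifs with hl
    · simpa [Nat.sub_add_cancel hl] using H (i - l)
    · simp
  have e : (q * r).coeff i = (q * X ^ Q.lo * (r * X ^ R.lo)).coeff (i + (Q.lo + R.lo)) := by
    rw [show q * X ^ Q.lo * (r * X ^ R.lo) = q * r * X ^ (Q.lo + R.lo) by ring, coeff_mul_X_pow]
  change (q * r).coeff i * 2 ^ (Q.scale + R.scale) ≤
    (digitPoly b h ^ (m + n)).coeff (i + (Q.lo + R.lo))
  rw [e, pow_add (digitPoly b h), coeff_mul, coeff_mul, Finset.sum_mul]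
  refine Finset.sum_le_sum fun x _ => ?_
  calc _ = ((q * X ^ Q.lo).coeff x.1 * 2 ^ Q.scale) * ((r * X ^ R.lo).coeff x.2 * 2 ^ R.scale) := by
        rw [pow_add]; ring
    _ ≤ _ := Nat.mul_le_mul (shift hqc _) (shift hrc _)

theorem slot_ones_le (hw : 0 < w) {v : ℕ} (hv : v < 2 ^ w) (L i : ℕ) :
    slot w (ones w v L) i ≤ v := by
  have e : ones w v L = ∑ i ∈ range L, v * (2 ^ w) ^ i := by
    rw [ones, pow_mul, ← Nat.geomSum_eq (Nat.le_self_pow hw.ne' 2), Finset.mul_sum]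
  rw [e, slot_sum L (fun _ => v) fun _ => hv]
  split_ifs <;> simp

theorem PolyBelow.trim (hb : 1 < b) (h0 : h 0 = 0) (hw : 0 < w) (p : ℕ) (win : ℕ → ℕ × ℕ) {n : ℕ}
    {Q : Packed} (hQ : PolyBelow b h w n Q) : SlotsBelow b h w n (trim b w p win n Q) := by
  rw [HappyNumbers.trim]
  rcases hg : Nat.blt (b ^ n) (2 ^ (Q.scale + w)) with _ | _
  · exact slotsBelow_zero w n
  · rw [Nat.blt_eq] at hg
    obtain ⟨q, hq, hc⟩ := hQ
    -- the total mass `b ^ n` bounds every coefficient, so that no slot has overflowed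
    have hlt : ∀ i, q.coeff i < 2 ^ w := fun i => by
      have := ((hc i).trans (coeff_digitPoly_pow_le hb h0 n _)).trans_lt hg
      rw [pow_add, mul_comm] at this
      exact lt_of_mul_lt_mul_left this (Nat.zero_le _)
    intro i
    simp only [cond_true]
    generalize (b ^ n).log2 - p - Q.scale = k
    generalize (win n).1 - Q.lo = a
    have hpos : 0 < 2 ^ (w - k) := by positivity
    have hle : 2 ^ (w - k) ≤ 2 ^ w := Nat.pow_le_pow_right (by norm_num) (Nat.sub_le w k)
    have h1 := slot_floor_le w Q.val (ones w (2 ^ (w - k) - 1) (win n).2) a k i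
      ((slot_ones_le hw (by omega) _ _).trans_lt (by omega))
    rw [← hq, slot_eval q hlt] at h1
    calc _ ≤ q.coeff (i + a) / 2 ^ k * 2 ^ (Q.scale + k) := by
          rw [← hq]; exact Nat.mul_le_mul_right _ h1
      _ = (q.coeff (i + a) / 2 ^ k * 2 ^ k) * 2 ^ Q.scale := by ring
      _ ≤ q.coeff (i + a) * 2 ^ Q.scale := Nat.mul_le_mul_right _ (Nat.div_mul_le_self _ _)
      _ ≤ _ := by
        have := hc (i + a)
        rwa [add_assoc, add_comm a] at this

theorem polyBelow_packedDigitPoly (b : ℕ) (h : ℕ → ℕ) (w : ℕ) :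
    PolyBelow b h w 1 ⟨0, 0, packedDigitPoly b h w⟩ := by
  refine ⟨digitPoly b h, ?_, fun i => by simp⟩
  rw [digitPoly, packedDigitPoly, eval_finsetSum]
  simp only [eval_pow, eval_X, ← pow_mul]
  rfl

theorem slotsBelow_packedPow (hb : 1 < b) (h0 : h 0 = 0) (hw : 0 < w) (p : ℕ) (win : ℕ → ℕ × ℕ)
    (f n : ℕ) : SlotsBelow b h w n (packedPow b h w p win f n) := by
  have hone : PolyBelow b h w 0 ⟨0, 0, 1⟩ := ⟨1, by simp, fun i => by simp⟩
  induction f generalizing n with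
  | zero => exact slotsBelow_zero w n
  | succ f ih =>
    rw [packedPow]
    rcases Nat.eq_zero_or_pos n with rfl | hn
    · intro i
      have := slot_eval (w := w) 1 (fun i => by
        rw [coeff_one]; split_ifs
        · exact Nat.one_lt_two_pow hw.ne'
        · positivity) i
      simp only [eval_one] at this
      simp [this]
    · have hn' : Nat.beq n 0 = false := by
        rw [← Bool.not_eq_true, Nat.beq_eq]
        omega
      rw [hn', cond_false]
      refine PolyBelow.trim hb h0 hw p win ?_
      have h2 := ((ih (n / 2)).polyBelow hw).mul ((ih (n / 2)).polyBelow hw)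
      rw [← two_mul, ← two_mul, ← two_mul] at h2
      rcases Nat.mod_two_eq_zero_or_one n with hm | hm
      · have := h2.mul hone
        rw [hm]
        convert this using 1
        · omega
        · rfl
      · have := h2.mul (polyBelow_packedDigitPoly b h w)
        rw [hm]
        convert this using 1
        · omega
        · rfl

theorem maskedSum_le (hb : 1 < b) (h0 : h 0 = 0) (hw : 0 < w) {n : ℕ} {Q : Packed}
    (hQ : SlotsBelow b h w n Q) (t : ℕ → Bool) (k c : ℕ) :
    maskedSum b h w t k c Q ≤
      #{y ∈ range (b ^ n) | t (happyMap b h (happyMap b h y)) = true} := by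
  obtain ⟨D, hD⟩ := mod_le_sum_slot hw
    (Q.val &&& ((maskRange b h t w k c (Q.lo / b ^ k)) >>> (w * (Q.lo % b ^ k))))
  refine (Nat.mul_le_mul_right _ hD).trans ?_
  rw [Finset.sum_mul]
  calc _ ≤ ∑ i ∈ range D, if t (happyMap b h (i + Q.lo)) = true then
          (digitPoly b h ^ n).coeff (i + Q.lo) else 0 := by
        refine Finset.sum_le_sum fun i _ => ?_
        rw [slot_land, slot_shiftRight]
        split_ifs with ht
        · exact (Nat.mul_le_mul_right _ Nat.and_le_left).trans (hQ i)
        · have : slot w (maskRange b h t w k c (Q.lo / b ^ k)) (i + Q.lo % b ^ k) = 0 := by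
            by_contra hne
            refine ht ?_
            have := slot_maskRange hb h0 t w k c _ _ hne
            rwa [add_left_comm, Nat.div_add_mod] at this
          rw [this]
          simp
    _ = ∑ y ∈ range (b ^ n), ∑ i ∈ range D,
          if t (happyMap b h (happyMap b h y)) = true ∧ happyMap b h y = i + Q.lo
            then 1 else 0 := by
        rw [Finset.sum_comm]
        refine Finset.sum_congr rfl fun i _ => ?_
        rw [coeff_digitPoly_pow hb h0]
        split_ifs with ht
        · refine Finset.sum_congr rfl fun y _ => ?_
          by_cases hy : happyMap b h y = i + Q.lo
          · simp [hy, ht]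
          · simp [hy]
        · symm
          refine Finset.sum_eq_zero fun y _ => if_neg ?_
          rintro ⟨h1, h2⟩
          exact ht (h2 ▸ h1)
    _ ≤ _ := by
        rw [Finset.card_filter]
        refine Finset.sum_le_sum fun y _ => ?_
        split_ifs with ht
        · simp only [ht, true_and]
          rw [← Finset.card_filter, Finset.card_le_one]
          intro i hi j hj
          simp only [Finset.mem_filter] at hi hj
          omega
        · simp [ht]

end PackedPower

/-! ### Averages over integers with `n` digits -/

section Averages

variable {b : ℕ} {h : ℕ → ℕ}

/-- The average of `g (y + happyMap b h x)` over `x < b ^ n`. -/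
noncomputable def avg (b : ℕ) (h : ℕ → ℕ) (n : ℕ) (g : ℕ → ℝ) (y : ℕ) : ℝ :=
  (∑ x ∈ range (b ^ n), g (y + happyMap b h x)) / (b : ℝ) ^ n

/-- The expected number of `n < M` with `y + H ∈ S`, where `H` is the sum of `h` over `n` random
digits and `g` is the indicator function of `S`. -/
noncomputable def visits (b : ℕ) (h : ℕ → ℕ) (M : ℕ) (g : ℕ → ℝ) (y : ℕ) : ℝ :=
  ∑ n ∈ range M, avg b h n g y

/-- The mean of `h` over a random digit. -/
noncomputable def digitMean (b : ℕ) (h : ℕ → ℕ) : ℝ :=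
  (∑ d ∈ range b, (h d : ℝ)) / b

/-- The variance of `h` over a random digit. -/
noncomputable def digitVar (b : ℕ) (h : ℕ → ℕ) : ℝ :=
  (∑ d ∈ range b, (h d : ℝ) ^ 2) / b - digitMean b h ^ 2

@[simp]
theorem avg_zero (g : ℕ → ℝ) (y : ℕ) : avg b h 0 g y = g y := by
  simp [avg]

/-- Conditioning on the last digit. -/
theorem avg_succ (hb : 1 < b) (h0 : h 0 = 0) (n : ℕ) (g : ℕ → ℝ) (y : ℕ) :
    avg b h (n + 1) g y = (∑ d ∈ range b, avg b h n g (y + h d)) / b := by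
  simp only [avg]
  rw [sum_range_pow_succ hb h0 n (fun x => g (y + x)), Finset.sum_comm, ← Finset.sum_div, div_div,
    pow_succ]
  simp only [add_assoc]

/-- Conditioning on all the digits but the last. -/
theorem avg_succ' (hb : 1 < b) (h0 : h 0 = 0) (n : ℕ) (g : ℕ → ℝ) (y : ℕ) :
    avg b h (n + 1) g y = avg b h n (fun z => (∑ d ∈ range b, g (z + h d)) / b) y := by
  simp only [avg]
  rw [sum_range_pow_succ hb h0 n (fun x => g (y + x)), ← Finset.sum_div, div_div, pow_succ']
  simp only [add_assoc, add_comm (h _)]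

theorem avg_mono {f g : ℕ → ℝ} (hfg : ∀ x, f x ≤ g x) (n y : ℕ) : avg b h n f y ≤ avg b h n g y :=
  div_le_div_of_nonneg_right (Finset.sum_le_sum fun _ _ => hfg _) (by positivity)

theorem avg_const (hb : 1 < b) (n : ℕ) (c : ℝ) (y : ℕ) : avg b h n (fun _ => c) y = c := by
  have : (b : ℝ) ^ n ≠ 0 := by positivity
  simp [avg, this]

theorem avg_add (n : ℕ) (f g : ℕ → ℝ) (y : ℕ) :
    avg b h n (fun x => f x + g x) y = avg b h n f y + avg b h n g y := by
  simp only [avg, Finset.sum_add_distrib, add_div]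

theorem avg_mul_const (n : ℕ) (f : ℕ → ℝ) (c : ℝ) (y : ℕ) :
    avg b h n (fun x => f x * c) y = avg b h n f y * c := by
  simp only [avg, ← Finset.sum_mul, div_mul_eq_mul_div]

theorem avg_sum {ι : Type*} (s : Finset ι) (n : ℕ) (f : ι → ℕ → ℝ) (y : ℕ) :
    avg b h n (fun x => ∑ i ∈ s, f i x) y = ∑ i ∈ s, avg b h n (f i) y := by
  simp only [avg]
  rw [Finset.sum_comm, Finset.sum_div]

theorem avg_mem_Icc (hb : 1 < b) {g : ℕ → ℝ} (hg : ∀ x, g x ∈ Set.Icc (0 : ℝ) 1) (n y : ℕ) :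
    avg b h n g y ∈ Set.Icc (0 : ℝ) 1 := by
  constructor
  · rw [← avg_const (h := h) hb n 0 y]
    exact avg_mono (fun x => (hg x).1) n y
  · rw [← avg_const (h := h) hb n 1 y]
    exact avg_mono (fun x => (hg x).2) n y

theorem avg_sq_sub (hb : 1 < b) (h0 : h 0 = 0) (n : ℕ) (a : ℝ) (y : ℕ) :
    avg b h n (fun x => ((x : ℝ) - a) ^ 2) y =
      (y + n * digitMean b h - a) ^ 2 + n * digitVar b h := by
  have hb' : (b : ℝ) ≠ 0 := by positivity
  induction n generalizing y with
  | zero => simp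
  | succ n ih =>
    rw [avg_succ hb h0]
    simp only [ih]
    have e : ∀ d, (((y + h d : ℕ) : ℝ) + n * digitMean b h - a) ^ 2 + n * digitVar b h =
        (h d : ℝ) ^ 2 + 2 * (y + n * digitMean b h - a) * h d +
          ((y + n * digitMean b h - a) ^ 2 + n * digitVar b h) := fun d => by push_cast; ring
    simp only [e, Finset.sum_add_distrib, ← Finset.mul_sum, Finset.sum_const, Finset.card_range,
      nsmul_eq_mul]
    have e1 : ∑ d ∈ range b, (h d : ℝ) = b * digitMean b h := by
      rw [digitMean]; field_simp
    have e2 : ∑ d ∈ range b, (h d : ℝ) ^ 2 = b * (digitVar b h + digitMean b h ^ 2) := by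
      rw [digitVar]; field_simp; ring
    rw [e1, e2]
    push_cast
    field_simp
    ring

theorem visits_succ (hb : 1 < b) (h0 : h 0 = 0) (M : ℕ) (g : ℕ → ℝ) (y : ℕ) :
    visits b h (M + 1) g y = g y + (∑ d ∈ range b, visits b h M g (y + h d)) / b := by
  rw [visits, Finset.sum_range_succ', avg_zero, add_comm]
  simp only [visits, avg_succ hb h0]
  rw [← Finset.sum_div, Finset.sum_comm]

/-- Coupling: of two walks, only the one that lags behind is moved until they meet. If `v` dominates
the expected number of moves in terms of the distance, it bounds the difference of the numbers of
visits. -/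
theorem abs_visits_sub_visits_le (hb : 1 < b) (h0 : h 0 = 0) {g : ℕ → ℝ}
    (hg : ∀ x, g x ∈ Set.Icc (0 : ℝ) 1) {K : ℕ} {v : ℕ → ℝ} (hK : ∀ d < b, h d ≤ K)
    (v0 : ∀ k, 0 ≤ v k)
    (hv : ∀ k, 0 < k → k ≤ K → 1 + (∑ d ∈ range b, v (Nat.dist k (h d))) / b ≤ v k)
    (M y k : ℕ) (hk : k ≤ K) : |visits b h M g (y + k) - visits b h M g y| ≤ v k := by
  induction M generalizing y k with
  | zero => simpa [visits] using v0 k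
  | succ M ih =>
    rcases Nat.eq_zero_or_pos k with rfl | hk0
    · simpa using v0 0
    · have hb' : (0 : ℝ) < b := by positivity
      have e1 : visits b h (M + 1) g (y + k) = visits b h M g (y + k) + avg b h M g (y + k) := by
        rw [visits, Finset.sum_range_succ, visits]
      rw [e1, visits_succ hb h0]
      have e2 : visits b h M g (y + k) + avg b h M g (y + k) -
          (g y + (∑ d ∈ range b, visits b h M g (y + h d)) / b) =
          (avg b h M g (y + k) - g y) +
            (∑ d ∈ range b, (visits b h M g (y + k) - visits b h M g (y + h d))) / b := by
        rw [Finset.sum_sub_distrib, Finset.sum_const, Finset.card_range, nsmul_eq_mul]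
        field_simp
        ring
      rw [e2]
      refine (abs_add_le _ _).trans (le_trans (add_le_add ?_ ?_) (hv k hk0 hk))
      · have h1 := avg_mem_Icc (h := h) hb hg M (y + k)
        have h2 := hg y
        rw [Set.mem_Icc] at h1 h2
        rw [abs_le]
        constructor <;> linarith
      · rw [abs_div, abs_of_pos hb']
        refine div_le_div_of_nonneg_right ((Finset.abs_sum_le_sum_abs _ _).trans
          (Finset.sum_le_sum fun d hd => ?_)) hb'.le
        have hd' := hK d (Finset.mem_range.1 hd)
        rcases le_total k (h d) with hkd | hkd
        · rw [Nat.dist_eq_sub_of_le hkd, abs_sub_comm]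
          have := ih (y + k) (h d - k) (by omega)
          rwa [add_assoc, Nat.add_sub_cancel' hkd] at this
        · rw [Nat.dist_eq_sub_of_le_right hkd]
          have := ih (y + h d) (k - h d) (by omega)
          rwa [add_assoc, Nat.add_sub_cancel' hkd] at this

/-- A telescoping sum: each of the `M` digits moves the summation bound from `z` to `z + h d`, and
the sum of `g` over these steps is counted by visits of the walk started at `i < h d`. -/
theorem avg_sum_range (hb : 1 < b) (h0 : h 0 = 0) (g : ℕ → ℝ) (M : ℕ) :
    avg b h M (fun x => ∑ i ∈ range x, g i) 0 =
      (∑ d ∈ range b, ∑ i ∈ range (h d), visits b h M g i) / b := by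
  have hb' : (b : ℝ) ≠ 0 := by positivity
  induction M with
  | zero => simp [visits]
  | succ M ih =>
    have e : ∀ z, (∑ d ∈ range b, ∑ i ∈ range (z + h d), g i) / (b : ℝ) =
        (∑ i ∈ range z, g i) + (∑ d ∈ range b, ∑ i ∈ range (h d), g (z + i)) * (b : ℝ)⁻¹ := by
      intro z
      simp only [Finset.sum_range_add, Finset.sum_add_distrib, Finset.sum_const, Finset.card_range,
        nsmul_eq_mul]
      field_simp
    have shift : ∀ i, avg b h M (fun z => g (z + i)) 0 = avg b h M g i := fun i => by
      simp only [avg, zero_add, add_comm i]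
    rw [avg_succ' hb h0]
    simp only [e]
    rw [avg_add, ih, avg_mul_const, avg_sum]
    simp only [avg_sum, shift]
    rw [← div_eq_mul_inv, ← add_div, ← Finset.sum_add_distrib]
    simp only [← Finset.sum_add_distrib, visits, Finset.sum_range_succ]

/-- A lower bound for the number of visits by the sum of `g` over an initial segment. -/
theorem sum_range_le_visits (hb : 1 < b) (h0 : h 0 = 0) {g : ℕ → ℝ}
    (hg : ∀ x, g x ∈ Set.Icc (0 : ℝ) 1) {V : ℝ}
    (hV : ∀ M, ∀ d < b, ∀ i < h d, visits b h M g i ≤ visits b h M g 0 + V) (M X : ℕ) {t : ℝ}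
    (ht : 0 < t) :
    ∑ i ∈ range X, g i ≤ digitMean b h * (visits b h M g 0 + V) +
      ((M * digitMean b h - X) ^ 2 + M * digitVar b h) / (2 * t) + t / 2 := by
  have hb' : (0 : ℝ) < b := by positivity
  have h1 : avg b h M (fun x => ∑ i ∈ range x, g i) 0 ≤
      digitMean b h * (visits b h M g 0 + V) := by
    rw [avg_sum_range hb h0, digitMean, div_mul_eq_mul_div, Finset.sum_mul]
    refine div_le_div_of_nonneg_right (Finset.sum_le_sum fun d hd => ?_) hb'.le
    calc _ ≤ ∑ i ∈ range (h d), (visits b h M g 0 + V) :=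
          Finset.sum_le_sum fun i hi => hV M d (Finset.mem_range.1 hd) i (Finset.mem_range.1 hi)
      _ = _ := by rw [Finset.sum_const, Finset.card_range, nsmul_eq_mul]
  have hmono : ∀ x y : ℕ, x ≤ y → ∑ i ∈ range y, g i ≤ ∑ i ∈ range x, g i + ((y : ℝ) - x) := by
    intro x y hxy
    obtain ⟨k, rfl⟩ := Nat.exists_eq_add_of_le hxy
    rw [Finset.sum_range_add]
    have : ∑ i ∈ range k, g (x + i) ≤ ∑ i ∈ range k, (1 : ℝ) :=
      Finset.sum_le_sum fun i _ => (hg _).2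
    simp only [Finset.sum_const, Finset.card_range, nsmul_eq_mul, mul_one] at this
    push_cast
    linarith
  have h2 : ∀ x : ℕ, ∑ i ∈ range X, g i - t / 2 ≤
      ∑ i ∈ range x, g i + ((x : ℝ) - X) ^ 2 * (2 * t)⁻¹ := by
    intro x
    -- the arithmetic-geometric mean inequality `|x - X| ≤ (x - X) ^ 2 / (2 * t) + t / 2`
    have ham : |(x : ℝ) - X| - t / 2 ≤ ((x : ℝ) - X) ^ 2 * (2 * t)⁻¹ := by
      rw [← div_eq_mul_inv, le_div_iff₀ (by positivity), ← sq_abs]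
      nlinarith [sq_nonneg (|(x : ℝ) - X| - t)]
    have hx : ∑ i ∈ range X, g i ≤ ∑ i ∈ range x, g i + |(x : ℝ) - X| := by
      rcases le_total x X with hxX | hxX
      · have := hmono x X hxX
        have := neg_abs_le ((x : ℝ) - X)
        linarith
      · have : ∑ i ∈ range X, g i ≤ ∑ i ∈ range x, g i :=
          Finset.sum_le_sum_of_subset_of_nonneg (Finset.range_mono hxX) fun i _ _ => (hg i).1
        have := abs_nonneg ((x : ℝ) - X)
        linarith
    linarith
  have h3 := avg_mono (b := b) (h := h) h2 M 0
  rw [avg_const hb, avg_add, avg_mul_const, avg_sq_sub hb h0] at h3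
  rw [← div_eq_mul_inv, Nat.cast_zero, zero_add] at h3
  linarith

end Averages

/-! ### Passing to larger powers of the base -/

section Tower

variable {b : ℕ} {h : ℕ → ℕ}

/-- The error in passing from `b ^ n` to a larger power of `b`, in units of `b ^ n`. Here `V` bounds
the effect of the starting point on the number of visits. -/
noncomputable def transferError (b : ℕ) (h : ℕ → ℕ) (V : ℝ) (n : ℕ) : ℝ :=
  digitMean b h * (n + 1 + V) + digitMean b h ^ 2 / 2 +
    (digitVar b h / (2 * digitMean b h) + 1 / 2) * √(b : ℝ) ^ n

theorem digitVar_nonneg (hb : 1 < b) (h0 : h 0 = 0) : 0 ≤ digitVar b h := by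
  have h1 := avg_sq_sub (h := h) hb h0 1 (digitMean b h) 0
  have h2 : 0 ≤ avg b h 1 (fun x => ((x : ℝ) - digitMean b h) ^ 2) 0 := by
    rw [← avg_const (h := h) hb 1 0 0]
    exact avg_mono (fun x => sq_nonneg _) 1 0
  simp at h1
  linarith

/-- If the sum of `g` over `[0, b ^ n)` is at least `d * b ^ n`, the average of `g` over the values
of `happyMap b h` on `[0, b ^ m)` is almost `d` for some `m > n`. -/
theorem exists_avg_ge (hb : 1 < b) (h0 : h 0 = 0) {g : ℕ → ℝ}
    (hg : ∀ x, g x ∈ Set.Icc (0 : ℝ) 1) {V : ℝ}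
    (hV : ∀ M, ∀ d < b, ∀ i < h d, visits b h M g i ≤ visits b h M g 0 + V)
    (hμ : 0 < digitMean b h) (n : ℕ) {d ε : ℝ}
    (hd : d * (b : ℝ) ^ n ≤ ∑ i ∈ range (b ^ n), g i)
    (hε : transferError b h V n < ε * (b : ℝ) ^ n) : ∃ m, n < m ∧ d - ε ≤ avg b h m g 0 := by
  by_contra! H
  set μ := digitMean b h
  have hX : (0 : ℝ) < (b : ℝ) ^ n := by positivity
  have he : 0 ≤ d - ε := (avg_mem_Icc (h := h) hb hg (n + 1) 0).1.trans (H _ n.lt_succ_self).le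
  set s : ℝ := √(b : ℝ) ^ n with hs
  have hs1 : 1 ≤ s := one_le_pow₀ (Real.one_le_sqrt.2 (by exact_mod_cast hb.le))
  have hss : s * s = (b : ℝ) ^ n := by
    rw [hs, ← mul_pow, Real.mul_self_sqrt (by positivity)]
  -- the walk reaches `b ^ n` after about `b ^ n / μ` steps
  set M := ⌊(b : ℝ) ^ n / μ⌋₊ with hM
  have hM1 : M * μ ≤ (b : ℝ) ^ n := by
    rw [← le_div_iff₀ hμ]; exact Nat.floor_le (by positivity)
  have hM2 : (b : ℝ) ^ n < M * μ + μ := by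
    have := Nat.lt_floor_add_one ((b : ℝ) ^ n / μ)
    rw [div_lt_iff₀ hμ] at this
    linarith
  have hvis : visits b h M g 0 ≤ (n + 1) + M * (d - ε) := by
    have hle : ∀ m, avg b h m g 0 ≤ (if m < n + 1 then 1 else 0) + (d - ε) := by
      intro m
      split_ifs with hm
      · linarith [(avg_mem_Icc (h := h) hb hg m 0).2]
      · linarith [H m (by omega)]
    calc visits b h M g 0 ≤ ∑ m ∈ range M, ((if m < n + 1 then 1 else 0) + (d - ε)) :=
          Finset.sum_le_sum fun m _ => hle m
      _ = (#{m ∈ range M | m < n + 1} : ℝ) + M * (d - ε) := by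
          rw [Finset.sum_add_distrib, Finset.sum_boole, Finset.sum_const, Finset.card_range,
            nsmul_eq_mul]
      _ ≤ _ := by
          gcongr
          have : #{m ∈ range M | m < n + 1} ≤ #(range (n + 1)) :=
            Finset.card_le_card fun m hm => by simp at hm ⊢; omega
          rw [Finset.card_range] at this
          exact_mod_cast this
  have key := sum_range_le_visits hb h0 hg hV M (b ^ n) (t := s) (by positivity)
  push_cast at key
  have hvar := digitVar_nonneg (h := h) hb h0
  have h1 : ((M * μ - (b : ℝ) ^ n) ^ 2 + M * digitVar b h) / (2 * s) ≤
      μ ^ 2 / 2 + digitVar b h / (2 * μ) * s := by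
    have h3 : M ≤ s * s / μ := by rw [hss, le_div_iff₀ hμ]; exact hM1
    have h4 : (M * μ - (b : ℝ) ^ n) ^ 2 ≤ μ ^ 2 := by
      rw [sq_le_sq, abs_of_pos hμ, abs_le]
      constructor <;> linarith
    have h5 : M * digitVar b h ≤ s * s / μ * digitVar b h := by gcongr
    rw [div_le_iff₀ (by positivity)]
    have h6 : (μ ^ 2 / 2 + digitVar b h / (2 * μ) * s) * (2 * s) =
        μ ^ 2 * s + s * s / μ * digitVar b h := by
      field_simp
    have h7 : μ ^ 2 ≤ μ ^ 2 * s := le_mul_of_one_le_right (by positivity) hs1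
    linarith
  have h2 : μ * (visits b h M g 0 + V) ≤ μ * (n + 1 + V) + (d - ε) * (b : ℝ) ^ n := by
    have : M * μ * (d - ε) ≤ (b : ℝ) ^ n * (d - ε) := by gcongr
    nlinarith [mul_le_mul_of_nonneg_left hvis hμ.le]
  rw [transferError] at hε
  linarith

/-- The relative error is at least halved when `n` is increased by one. -/
theorem transferError_succ (hb : 4 ≤ b) (h0 : h 0 = 0) {V : ℝ} (hV : 0 ≤ V)
    (hμ : 0 < digitMean b h) {n : ℕ} {ε : ℝ} (hε : transferError b h V n < ε * (b : ℝ) ^ n) :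
    transferError b h V (n + 1) < ε / 2 * (b : ℝ) ^ (n + 1) := by
  have hs2 : 2 ≤ √(b : ℝ) := by
    rw [Real.le_sqrt' (by norm_num)]
    exact_mod_cast (by omega : 2 ^ 2 ≤ b)
  have hvar := digitVar_nonneg (h := h) (by omega : 1 < b) h0
  have hss : √(b : ℝ) * √(b : ℝ) = b := Real.mul_self_sqrt (by positivity)
  have h1 : transferError b h V (n + 1) ≤ √(b : ℝ) * transferError b h V n := by
    rw [transferError, transferError, pow_succ √(b : ℝ) n]
    have a1 : digitMean b h * ((n + 1 : ℕ) + 1 + V) ≤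
        √(b : ℝ) * (digitMean b h * (n + 1 + V)) := by
      have : ((n + 1 : ℕ) + 1 + V : ℝ) ≤ 2 * (n + 1 + V) := by
        push_cast; linarith [(Nat.cast_nonneg n : (0 : ℝ) ≤ n)]
      calc _ ≤ digitMean b h * (2 * (n + 1 + V)) := by gcongr
        _ = 2 * (digitMean b h * (n + 1 + V)) := by ring
        _ ≤ _ := by gcongr
    have a2 : digitMean b h ^ 2 / 2 ≤ √(b : ℝ) * (digitMean b h ^ 2 / 2) :=
      le_mul_of_one_le_left (by positivity) (by linarith)
    linarith
  have hpos : 0 < ε * (b : ℝ) ^ n := by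
    refine lt_of_le_of_lt ?_ hε
    rw [transferError]
    positivity
  calc _ ≤ √(b : ℝ) * transferError b h V n := h1
    _ < √(b : ℝ) * (ε * (b : ℝ) ^ n) := by gcongr
    _ ≤ √(b : ℝ) * (√(b : ℝ) / 2) * (ε * (b : ℝ) ^ n) := by
      gcongr
      exact le_mul_of_one_le_right (by positivity) (by linarith)
    _ = _ := by
      rw [pow_succ]
      linear_combination ε * (b : ℝ) ^ n / 2 * hss

theorem transferError_lt_of_le (hb : 4 ≤ b) (h0 : h 0 = 0) {V : ℝ} (hV : 0 ≤ V)
    (hμ : 0 < digitMean b h) {n : ℕ} {ε : ℝ} (hε : transferError b h V n < ε * (b : ℝ) ^ n)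
    (k m : ℕ) (hm : n + k ≤ m) : transferError b h V m < ε / 2 ^ k * (b : ℝ) ^ m := by
  have hpos : 0 < ε := by
    have : 0 < ε * (b : ℝ) ^ n := by
      refine lt_of_le_of_lt ?_ hε
      have := digitVar_nonneg (h := h) (by omega : 1 < b) h0
      rw [transferError]
      positivity
    exact pos_of_mul_pos_left this (by positivity)
  have h1 : ∀ j, transferError b h V (n + j) < ε / 2 ^ j * (b : ℝ) ^ (n + j) := by
    intro j
    induction j with
    | zero => simpa using hε
    | succ j ih =>
      have := transferError_succ hb h0 hV hμ ih
      rwa [div_div, ← pow_succ] at this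
  obtain ⟨j, rfl⟩ := Nat.exists_eq_add_of_le ((Nat.le_add_right n k).trans hm)
  refine (h1 j).trans_le ?_
  gcongr
  · norm_num
  · omega

/-- The density `d` on `[0, b ^ n)` persists, up to the sum of a geometric series of errors, on
`[0, b ^ m)` for arbitrarily large `m`. -/
theorem frequently_avg_ge (hb : 4 ≤ b) (h0 : h 0 = 0) {g : ℕ → ℝ}
    (hg : ∀ x, g x ∈ Set.Icc (0 : ℝ) 1) (hgH : ∀ x, g (happyMap b h x) = g x) {V : ℝ} (hV0 : 0 ≤ V)
    (hV : ∀ M, ∀ d < b, ∀ i < h d, visits b h M g i ≤ visits b h M g 0 + V)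
    (hμ : 0 < digitMean b h) {n : ℕ} {d ε : ℝ} (hd : d ≤ avg b h n g 0)
    (hε : transferError b h V n < ε * (b : ℝ) ^ n) (N : ℕ) :
    ∃ m ≥ N, d - 2 * ε ≤ avg b h m g 0 := by
  have hb1 : 1 < b := by omega
  have hsum : ∀ m, avg b h m g 0 * (b : ℝ) ^ m = ∑ i ∈ range (b ^ m), g i := fun m => by
    rw [avg, div_mul_cancel₀ _ (by positivity)]
    simp only [zero_add, hgH]
  have hε0 : 0 ≤ ε := by
    by_contra! hneg
    have hvar := digitVar_nonneg (h := h) hb1 h0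
    have h1 : 0 ≤ transferError b h V n := by rw [transferError]; positivity
    have h2 : ε * (b : ℝ) ^ n ≤ 0 := mul_nonpos_of_nonpos_of_nonneg hneg.le (by positivity)
    linarith
  have key : ∀ k : ℕ, ∃ m ≥ n + k, d - 2 * ε * (1 - 1 / 2 ^ k) ≤ avg b h m g 0 := by
    intro k
    induction k with
    | zero => exact ⟨n, le_rfl, by simpa using hd⟩
    | succ k ih =>
      obtain ⟨m, hm, hdm⟩ := ih
      obtain ⟨m', hm', hdm'⟩ := exists_avg_ge hb1 h0 hg hV hμ m
        (d := d - 2 * ε * (1 - 1 / 2 ^ k)) (by rw [← hsum]; gcongr)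
        (transferError_lt_of_le hb h0 hV0 hμ hε k m hm)
      refine ⟨m', by omega, le_of_eq_of_le ?_ hdm'⟩
      rw [pow_succ]
      field_simp
      ring
  obtain ⟨m, hm, hdm⟩ := key N
  refine ⟨m, by omega, le_trans ?_ hdm⟩
  have : 0 ≤ 2 * ε * (1 / 2 ^ N) := by positivity
  linarith

end Tower

/-! ### Densities -/

section Densities

theorem relDensity_nonneg (S : Set ℕ) (N : ℕ) : 0 ≤ relDensity S N := by
  unfold relDensity; positivity

theorem relDensity_le_one (S : Set ℕ) (N : ℕ) : relDensity S N ≤ 1 := by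
  refine div_le_one_of_le₀ ?_ (by positivity)
  have h1 := Set.ncard_le_ncard (Set.inter_subset_right (s := S) (t := Set.Icc 1 N))
    (Set.finite_Icc 1 N)
  rw [← Finset.coe_Icc, Set.ncard_coe_finset, Nat.card_Icc] at h1
  rw [← Finset.coe_Icc]
  exact_mod_cast h1

theorem relDensity_compl (S : Set ℕ) {N : ℕ} (hN : 0 < N) :
    relDensity Sᶜ N = 1 - relDensity S N := by
  have h1 := Set.ncard_inter_add_ncard_sdiff_eq_ncard (Set.Icc 1 N) S (Set.finite_Icc 1 N)
  rw [← Finset.coe_Icc, Set.ncard_coe_finset, Nat.card_Icc] at h1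
  have hN' : (N : ℝ) ≠ 0 := by positivity
  rw [relDensity, relDensity, eq_sub_iff_add_eq, ← add_div, div_eq_one_iff_eq hN', ← Finset.coe_Icc]
  rw [Set.sdiff_eq, Set.inter_comm _ S, Set.inter_comm _ Sᶜ, add_comm] at h1
  exact_mod_cast h1

theorem upperDensity_eq_of_hasDensity {S : Set ℕ} {d : ℝ} (hS : HasDensity S d) :
    upperDensity S = d :=
  Tendsto.limsup_eq hS

theorem lowerDensity_eq_of_hasDensity {S : Set ℕ} {d : ℝ} (hS : HasDensity S d) :
    lowerDensity S = d :=
  Tendsto.liminf_eq hS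

theorem not_hasDensity_of_lt {S : Set ℕ} (hS : lowerDensity S < upperDensity S) :
    ¬ ∃ d : ℝ, HasDensity S d := by
  rintro ⟨d, hd⟩
  rw [upperDensity_eq_of_hasDensity hd, lowerDensity_eq_of_hasDensity hd] at hS
  exact hS.false

theorem le_upperDensity {S : Set ℕ} {e : ℝ} (hS : ∃ᶠ N in atTop, e ≤ relDensity S N) :
    e ≤ upperDensity S :=
  le_limsup_of_frequently_le hS (isBoundedUnder_of ⟨1, relDensity_le_one S⟩)

theorem lowerDensity_le {S : Set ℕ} {e : ℝ} (hS : ∃ᶠ N in atTop, relDensity S N ≤ e) :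
    lowerDensity S ≤ e :=
  liminf_le_of_frequently_le hS (isBoundedUnder_of ⟨0, relDensity_nonneg S⟩)

variable {b : ℕ} {h : ℕ → ℕ}

/-- The averages over `[0, b ^ m)` differ from the relative densities only by the integer `0`. -/
theorem avg_indicator_le_relDensity {S : Set ℕ} (hS : ∀ x, happyMap b h x ∈ S ↔ x ∈ S) (m : ℕ) :
    avg b h m (S.indicator 1) 0 ≤ relDensity S (b ^ m) + 1 / (b : ℝ) ^ m := by
  classical
  have h1 : ∑ x ∈ range (b ^ m), S.indicator (1 : ℕ → ℝ) (0 + happyMap b h x) =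
      (#{x ∈ range (b ^ m) | x ∈ S} : ℝ) := by
    rw [Finset.card_filter]
    push_cast
    refine Finset.sum_congr rfl fun x _ => ?_
    simp only [Set.indicator_apply, zero_add, hS, Pi.one_apply]
  have h2 : #{x ∈ range (b ^ m) | x ∈ S} ≤ (S ∩ Set.Icc 1 (b ^ m)).ncard + 1 := by
    have hfin : (S ∩ Set.Icc 1 (b ^ m)).Finite := (Set.finite_Icc _ _).inter_of_right S
    rw [← Set.ncard_coe_finset]
    refine (Set.ncard_le_ncard (t := insert 0 (S ∩ Set.Icc 1 (b ^ m))) ?_ (hfin.insert 0)).trans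
      (Set.ncard_insert_le _ _)
    intro x hx
    simp only [Finset.coe_filter, Finset.mem_range, Set.mem_ofPred_eq] at hx
    rcases Nat.eq_zero_or_pos x with rfl | hx0
    · exact Set.mem_insert _ _
    · exact Set.mem_insert_of_mem _ ⟨hx.2, hx0, hx.1.le⟩
  rw [avg, h1, relDensity, Nat.cast_pow, ← add_div]
  gcongr
  exact_mod_cast h2

/-- If a set compatible with `happyMap b h` has density at least `d` in `[0, b ^ n)`, its relative
density is nearly `d` infinitely often. -/
theorem frequently_le_relDensity (hb : 4 ≤ b) (h0 : h 0 = 0) {S : Set ℕ}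
    (hS : ∀ x, happyMap b h x ∈ S ↔ x ∈ S) {V : ℝ} (hV0 : 0 ≤ V)
    (hV : ∀ g : ℕ → ℝ, (∀ x, g x ∈ Set.Icc (0 : ℝ) 1) →
      ∀ M, ∀ d < b, ∀ i < h d, visits b h M g i ≤ visits b h M g 0 + V)
    (hμ : 0 < digitMean b h) {n : ℕ} {d ε e : ℝ} (hd : d ≤ avg b h n (S.indicator 1) 0)
    (hε : transferError b h V n < ε * (b : ℝ) ^ n) (he : e < d - 2 * ε) :
    ∃ᶠ m in atTop, e ≤ relDensity S (b ^ m) := by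
  have hg : ∀ x, S.indicator (1 : ℕ → ℝ) x ∈ Set.Icc (0 : ℝ) 1 := fun x => by
    by_cases hx : x ∈ S <;> simp [hx]
  have hlim : Tendsto (fun m : ℕ => 1 / (b : ℝ) ^ m) atTop (𝓝 0) := by
    have hb1 : (1 : ℝ) < b := by exact_mod_cast (by omega : 1 < b)
    simp only [one_div]
    exact tendsto_inv_atTop_zero.comp (tendsto_pow_atTop_atTop_of_one_lt hb1)
  have hev := hlim.eventually (gt_mem_nhds (sub_pos.2 he))
  have hfr : ∃ᶠ m in atTop, d - 2 * ε ≤ avg b h m (S.indicator 1) 0 := by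
    rw [frequently_atTop]
    refine frequently_avg_ge hb h0 hg (fun x => ?_) hV0 (hV _ hg) hμ hd hε
    by_cases hx : x ∈ S <;> simp [hx, hS]
  refine (hfr.and_eventually hev).mono fun m hm => ?_
  have := avg_indicator_le_relDensity hS m
  linarith [hm.1, hm.2]

end Densities

/-! ### Cycles and type sets -/

section TypeSets

variable {H : ℕ → ℕ}

theorem iterate_mem_iff {S : Set ℕ} (hS : ∀ x, H x ∈ S ↔ x ∈ S) (k x : ℕ) :
    H^[k] x ∈ S ↔ x ∈ S := by
  induction k generalizing x with
  | zero => rfl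
  | succ k ih => rw [Function.iterate_succ_apply, ih, hS]

theorem map_mem_typeSet_iff (hz : H 0 = 0) (hpos : ∀ x, 0 < x → 0 < H x) {C : Set ℕ}
    (hC : ∀ c ∈ C, H c ∈ C) (x : ℕ) : H x ∈ typeSet H C ↔ x ∈ typeSet H C := by
  constructor
  · rintro ⟨hx, k, hk⟩
    refine ⟨Nat.pos_of_ne_zero ?_, k + 1, hk⟩
    rintro rfl
    rw [hz] at hx
    exact hx.false
  · rintro ⟨hx, k, hk⟩
    refine ⟨hpos x hx, k, ?_⟩
    rw [← Function.iterate_succ_apply, Function.iterate_succ_apply']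
    exact hC _ hk

theorem notMem_typeSet {C D : Set ℕ} (hD : ∀ x ∈ D, H x ∈ D) (hCD : ∀ x ∈ D, x ∉ C) :
    ∀ x ∈ D, x ∉ typeSet H C := by
  rintro x hx ⟨-, k, hk⟩
  have : ∀ k, H^[k] x ∈ D := fun k => by
    induction k with
    | zero => exact hx
    | succ k ih => rw [Function.iterate_succ_apply']; exact hD _ ih
  exact hCD _ (this k) hk

theorem exists_iterate_mem {P : ℕ → Prop} {B : ℕ} (hlt : ∀ n, B ≤ n → H n < n)
    (hpos : ∀ n, 0 < n → 0 < H n) (hP : ∀ n, 0 < n → n < B → ∃ k, P (H^[k] n)) {n : ℕ} (hn : 0 < n) :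
    ∃ k, P (H^[k] n) := by
  induction n using Nat.strong_induction_on with
  | _ n ih =>
    rcases lt_or_ge n B with h | h
    · exact hP n hn h
    · obtain ⟨k, hk⟩ := ih _ (hlt n h) (hpos n hn)
      exact ⟨k + 1, hk⟩

/-- A periodic point and any point on its trajectory have the same trajectory. -/
theorem orbit_eq_of_iterate {x c k : ℕ} (hx : x ∈ Function.periodicPts H) (hk : H^[k] x = c) :
    {y | ∃ j : ℕ, H^[j] x = y} = {y | ∃ j : ℕ, H^[j] c = y} := by
  obtain ⟨p, hp, hper⟩ := hx
  ext y
  constructor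
  · rintro ⟨j, rfl⟩
    refine ⟨j + (p * k - k), ?_⟩
    have hle : k ≤ p * k := Nat.le_mul_of_pos_left k hp
    rw [← hk, ← Function.iterate_add_apply, add_assoc, Nat.sub_add_cancel hle,
      Function.iterate_add_apply, (hper.mul_const k).eq]
  · rintro ⟨j, rfl⟩
    exact ⟨j + k, by rw [Function.iterate_add_apply, hk]⟩

theorem orbit_eq_image {c p : ℕ} (hp : 0 < p) (hc : Function.IsPeriodicPt H p c) :
    {y | ∃ j : ℕ, H^[j] c = y} = {y | y ∈ (List.range p).map fun j => H^[j] c} := by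
  ext y
  simp only [Set.mem_ofPred_eq, List.mem_map, List.mem_range]
  constructor
  · rintro ⟨j, rfl⟩
    exact ⟨j % p, Nat.mod_lt _ hp, hc.iterate_mod_apply j⟩
  · rintro ⟨j, -, rfl⟩
    exact ⟨j, rfl⟩

/-- The cycles of `H` are those listed in `L`, each in the order of the trajectory of its first
entry, if every trajectory meets one of the first entries. -/
theorem cycles_eq {L : List (List ℕ)}
    (hL : ∀ l ∈ L, 0 < l.headI ∧ 0 < l.length ∧ H^[l.length] l.headI = l.headI ∧
      ((List.range l.length).map fun j => H^[j] l.headI) = l)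
    (hreach : ∀ n, 0 < n → ∃ k, ∃ l ∈ L, H^[k] n = l.headI) :
    cycles H = {C | ∃ l ∈ L, C = {y | y ∈ l}} := by
  ext C
  constructor
  · rintro ⟨x, hx, hper, rfl⟩
    obtain ⟨k, l, hl, hk⟩ := hreach x hx
    obtain ⟨-, h2, h3, h4⟩ := hL l hl
    refine ⟨l, hl, ?_⟩
    rw [orbit_eq_of_iterate hper hk, orbit_eq_image h2 h3, h4]
  · rintro ⟨l, hl, rfl⟩
    obtain ⟨h1, h2, h3, h4⟩ := hL l hl
    refine ⟨l.headI, h1, ⟨l.length, h2, h3⟩, ?_⟩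
    rw [orbit_eq_image h2 h3, h4]

end TypeSets

/-! ### Density bounds from finite computations -/

section Certificates

/-- The largest value of `h` on digits that is at most `k`. -/
def greedyPart (b : ℕ) (h : ℕ → ℕ) (k : ℕ) : ℕ :=
  (List.range b).foldl (fun m d => bif Nat.ble (h d) k then max m (h d) else m) 0

/-- An upper bound for the expected number of moves until two walks at distance `k` meet. If `s ≤ f`
successive greedy moves reduce the distance to zero, the value is
`b ^ f + b ^ (f - 1) + … + b ^ (f - s + 1)`: each greedy move has probability at least `1 / b`, and any
other move is taken to lead to the worst distance, where `s = f`. -/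
def meetingCost (b : ℕ) (h : ℕ → ℕ) : ℕ → ℕ → ℕ
  | 0, _ => 0
  | f + 1, k => bif Nat.beq k 0 then 0 else b ^ (f + 1) + meetingCost b h f (k - greedyPart b h k)

/-- The inequalities that make `meetingCost b h f` dominate the expected meeting time for distances
up to `K`, and the bound `V` for its values. -/
def checkMeetingCost (b : ℕ) (h : ℕ → ℕ) (f K V : ℕ) : Bool :=
  (List.range (K + 1)).all fun k => Nat.ble (meetingCost b h f k) V &&
    (Nat.beq k 0 || Nat.ble (b + ((List.range b).map fun d =>
      force (Nat.dist k (h d)) (meetingCost b h f)).sum) (b * meetingCost b h f k))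

variable {b : ℕ} {h : ℕ → ℕ}

theorem visits_le_of_checkMeetingCost (hb : 1 < b) (h0 : h 0 = 0) {f K V : ℕ}
    (hK : ∀ d < b, h d ≤ K) (hc : checkMeetingCost b h f K V = true) (g : ℕ → ℝ)
    (hg : ∀ x, g x ∈ Set.Icc (0 : ℝ) 1) (M d : ℕ) (hd : d < b) (i : ℕ) (hi : i < h d) :
    visits b h M g i ≤ visits b h M g 0 + V := by
  have hc' : ∀ k ≤ K, meetingCost b h f k ≤ V ∧ (k = 0 ∨
      b + ∑ d ∈ range b, meetingCost b h f (Nat.dist k (h d)) ≤ b * meetingCost b h f k) := by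
    intro k hk
    have := List.all_eq_true.1 hc k (List.mem_range.2 (by omega))
    simp only [Bool.and_eq_true, Bool.or_eq_true, Nat.ble_eq, Nat.beq_eq, force_eq] at this
    exact this
  have hb' : (0 : ℝ) < b := by positivity
  have hiK : i ≤ K := hi.le.trans (hK d hd)
  have := abs_visits_sub_visits_le hb h0 hg (v := fun k => (meetingCost b h f k : ℝ)) hK
    (fun k => by positivity) (fun k hk0 hk => by
      have := (hc' k hk).2.resolve_left hk0.ne'
      rw [← le_sub_iff_add_le', div_le_iff₀ hb', sub_mul, one_mul, le_sub_iff_add_le']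
      rw [mul_comm b] at this
      exact_mod_cast this) M 0 i hiK
  rw [zero_add] at this
  have h2 : (meetingCost b h f i : ℝ) ≤ V := by exact_mod_cast (hc' i hiK).1
  linarith [le_abs_self (visits b h M g i - visits b h M g 0)]

theorem le_avg_of_maskedSum (hb : 1 < b) (h0 : h 0 = 0) {S : Set ℕ}
    (hS : ∀ x, happyMap b h x ∈ S ↔ x ∈ S) {L : List ℕ} (hL : ∀ l ∈ L, l ∈ S) {w : ℕ} (hw : 0 < w)
    {p f n j k c num den : ℕ} {win : ℕ → ℕ × ℕ} (hden : 0 < den)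
    (hsum : num * b ^ n ≤
      maskedSum b h w (meets b h L j) k c (packedPow b h w p win f n) * den) :
    (num : ℝ) / den ≤ avg b h n (S.indicator 1) 0 := by
  classical
  have h1 := hsum.trans (Nat.mul_le_mul_right _
    (maskedSum_le hb h0 hw (slotsBelow_packedPow hb h0 hw p win f n) (meets b h L j) k c))
  have h2 : (#{y ∈ range (b ^ n) | meets b h L j (happyMap b h (happyMap b h y)) = true} : ℝ) ≤
      ∑ x ∈ range (b ^ n), S.indicator (1 : ℕ → ℝ) (0 + happyMap b h x) := by
    rw [Finset.card_filter]
    push_cast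
    refine Finset.sum_le_sum fun x _ => ?_
    rw [zero_add, Set.indicator_apply]
    split_ifs with hx hxS hxS
    · rfl
    · obtain ⟨i, hi⟩ := exists_iterate_mem_of_meets hb h0 hx
      exact absurd ((hS _).1 ((iterate_mem_iff hS i _).1 (hL _ hi))) hxS
    · exact zero_le_one
    · rfl
  have hden' : (0 : ℝ) < den := by exact_mod_cast hden
  rw [avg, div_le_div_iff₀ hden' (by positivity)]
  calc (num : ℝ) * (b : ℝ) ^ n ≤
        #{y ∈ range (b ^ n) | meets b h L j (happyMap b h (happyMap b h y)) = true} * den := by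
        exact_mod_cast h1
    _ ≤ _ := by gcongr

/-- The computation that certifies a lower bound `num / den` for the density in `[0, b ^ n)` of the
integers whose trajectories meet `L`. The slots have `96` bits and coefficients are rounded so that
their sum has about `44` bits; at most `20` squarings and `20` steps of a trajectory are made, and
`c` blocks of `b ^ 3` exponents are inspected. -/
def certifies (b : ℕ) (h : ℕ → ℕ) (win : ℕ → ℕ × ℕ) (L : List ℕ) (n c num den : ℕ) : Bool :=
  Nat.ble (num * b ^ n)
    (maskedSum b h 96 (meets b h L 20) 3 c (packedPow b h 96 43 win 20 n) * den)

/-- Bounds for the densities of a type set. The list `L` holds the elements of `C`, the list `L'` those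
of the other cycles. -/
theorem density_bounds (hb : 4 ≤ b) (h0 : h 0 = 0) (hpos : ∀ d, 0 < d → d < b → 0 < h d)
    (hμ : 0 < digitMean b h) {V : ℕ}
    (hV : ∀ g : ℕ → ℝ, (∀ x, g x ∈ Set.Icc (0 : ℝ) 1) →
      ∀ M, ∀ d < b, ∀ i < h d, visits b h M g i ≤ visits b h M g 0 + V)
    {C : Set ℕ} {L L' : List ℕ} (hC : ∀ x, x ∈ C ↔ x ∈ L) (hL0 : ∀ x ∈ L, 0 < x)
    (hL : ∀ x ∈ L, fastMap b h 10 x ∈ L) (hL' : ∀ x ∈ L', fastMap b h 10 x ∈ L')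
    (hLL' : ∀ x ∈ L', x ∉ L) {win : ℕ → ℕ × ℕ} {n n' c c' num num' den : ℕ} {ε u l : ℝ}
    (hden : 0 < den) (hn : certifies b h win L n c num den = true)
    (hn' : certifies b h win L' n' c' num' den = true)
    (hε : transferError b h V n < ε * (b : ℝ) ^ n)
    (hε' : transferError b h V n' < ε * (b : ℝ) ^ n') (hu : u < (num : ℝ) / den - 2 * ε)
    (hl : 1 - l < (num' : ℝ) / den - 2 * ε) (hlu : l ≤ u) :
    u < upperDensity (typeSet (happyMap b h) C) ∧ lowerDensity (typeSet (happyMap b h) C) < l ∧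
      ¬ ∃ d : ℝ, HasDensity (typeSet (happyMap b h) C) d := by
  have hb1 : 1 < b := by omega
  simp only [fastMap_eq hb1 h0] at hL hL'
  have hS := map_mem_typeSet_iff (happyMap_zero b h) (fun x => happyMap_pos hb1 h0 hpos)
    (C := C) (fun c hc => (hC _).2 (hL c ((hC c).1 hc)))
  have hS' : ∀ x, happyMap b h x ∈ (typeSet (happyMap b h) C)ᶜ ↔ x ∈ (typeSet (happyMap b h) C)ᶜ :=
    fun x => not_congr (hS x)
  have hpow : Tendsto (fun m : ℕ => b ^ m) atTop atTop := tendsto_pow_atTop_atTop_of_one_lt hb1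
  have hup : u < upperDensity (typeSet (happyMap b h) C) := by
    obtain ⟨e, hue, he⟩ := exists_between hu
    refine hue.trans_le (le_upperDensity (hpow.frequently ?_))
    refine frequently_le_relDensity hb h0 hS V.cast_nonneg hV hμ ?_ hε he
    exact le_avg_of_maskedSum hb1 h0 hS (fun x hx => ⟨hL0 x hx, 0, (hC x).2 hx⟩)
      (by norm_num : 0 < 96) hden (Nat.le_of_ble_eq_true hn)
  have hlow : lowerDensity (typeSet (happyMap b h) C) < l := by
    obtain ⟨e, hle, he⟩ := exists_between hl
    refine lt_of_le_of_lt (lowerDensity_le (e := 1 - e) (hpow.frequently ?_)) (by linarith)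
    refine (frequently_le_relDensity hb h0 hS' V.cast_nonneg hV hμ
      (le_avg_of_maskedSum hb1 h0 hS' ?_ (by norm_num : 0 < 96) hden (Nat.le_of_ble_eq_true hn'))
      hε' he).mono fun m hm => ?_
    · exact notMem_typeSet (D := {x | x ∈ L'}) hL' fun x hx hxC => hLL' x hx ((hC x).1 hxC)
    · rw [relDensity_compl _ (by positivity)] at hm
      linarith
  exact ⟨hup, hlow, not_hasDensity_of_lt (by linarith)⟩

end Certificates

/-! ### Sums of cubes of decimal digits -/

section Cubes

/-- The cycles of `cubeMap`. -/
def cubeCycles : List (List ℕ) :=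
  [[1], [55, 250, 133], [136, 244], [153], [160, 217, 352], [370], [371], [407], [919, 1459]]

/-- A rational approximation to the square root: one step of Newton's method. -/
def sqrtApprox (n : ℕ) : ℕ :=
  (2 ^ ((n.log2 + 1) / 2) + n / 2 ^ ((n.log2 + 1) / 2)) / 2 + 1

/-- The first exponent and the number of exponents kept in the `n`-th power: about six standard
deviations to both sides of the mean `202.5 * n`. -/
def cubeWindow (n : ℕ) : ℕ × ℕ :=
  ((202 * n - 1450 * sqrtApprox n) / 1000 * 1000, 2 * 1450 * sqrtApprox n + 3000)

theorem cubeMap_eq_fastMap : cubeMap = fastMap 10 (fun d => d ^ 3) 10 :=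
  funext fun n => (fastMap_eq (by norm_num) (by norm_num) 10 n).symm

theorem cubeMap_pos {n : ℕ} (hn : 0 < n) : 0 < cubeMap n :=
  happyMap_pos (by norm_num) (by norm_num) (fun d hd _ => by positivity) hn

theorem cubeMap_le (n : ℕ) : cubeMap n ≤ n / 2 + 2000 := by
  induction n using Nat.strong_induction_on with
  | _ n ih =>
    rcases lt_or_ge n 2000 with hn | hn
    · have key : (List.range 2000).all (fun n =>
          Nat.ble (fastMap 10 (fun d => d ^ 3) 10 n) (n / 2 + 2000)) = true := by decide +kernel
      have := List.all_eq_true.1 key n (List.mem_range.2 hn)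
      rw [cubeMap_eq_fastMap]
      exact Nat.le_of_ble_eq_true this
    · have h1 : cubeMap n = (n % 10) ^ 3 + cubeMap (n / 10) :=
        happyMap_eq (by norm_num) (by norm_num) n
      have h2 := ih (n / 10) (by omega)
      have h3 : (n % 10) ^ 3 ≤ 9 ^ 3 := Nat.pow_le_pow_left (by omega) 3
      omega

theorem exists_iterate_cubeMap_mem {n : ℕ} (hn : 0 < n) :
    ∃ k, ∃ l ∈ cubeCycles, cubeMap^[k] n = l.headI := by
  refine exists_iterate_mem (H := cubeMap) (P := fun x => ∃ l ∈ cubeCycles, x = l.headI) (B := 4001)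
    (fun n hn => ?_) (fun n => cubeMap_pos) (fun n hn hlt => ?_) hn
  · have := cubeMap_le n
    omega
  · have key : (List.range 4001).all (fun n => Nat.beq n 0 ||
        meets 10 (fun d => d ^ 3) (cubeCycles.map List.headI) 20 n) = true := by decide +kernel
    have := List.all_eq_true.1 key n (List.mem_range.2 hlt)
    rw [Bool.or_eq_true, Nat.beq_eq] at this
    obtain ⟨k, hk⟩ := exists_iterate_mem_of_meets (by norm_num) (by norm_num)
      (this.resolve_left hn.ne')
    obtain ⟨l, hl, hlk⟩ := List.mem_map.1 hk
    exact ⟨k, l, hl, hlk.symm⟩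

theorem cycles_cubeMap : cycles cubeMap =
    {{1}, {55, 250, 133}, {136, 244}, {153}, {160, 217, 352}, {370}, {371}, {407},
      {919, 1459}} := by
  rw [cycles_eq (L := cubeCycles) (by rw [cubeMap_eq_fastMap]; decide +kernel)
    fun n hn => exists_iterate_cubeMap_mem hn]
  ext C
  simp [cubeCycles, Set.ext_iff]

/-- Every number up to `729` is a sum of at most `12` cubes chosen greedily, so the starting point
changes the number of visits by less than `10 ^ 13`. -/
theorem visits_cube_le (g : ℕ → ℝ) (hg : ∀ x, g x ∈ Set.Icc (0 : ℝ) 1) (M d : ℕ) (hd : d < 10)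
    (i : ℕ) (hi : i < d ^ 3) : visits 10 (fun d => d ^ 3) M g i ≤
      visits 10 (fun d => d ^ 3) M g 0 + (10 ^ 13 : ℕ) :=
  visits_le_of_checkMeetingCost (h := fun d => d ^ 3) (by norm_num) (by norm_num) (f := 12) (K := 729)
    (fun d hd => (Nat.pow_le_pow_left (by omega : d ≤ 9) 3).trans (by norm_num)) (by decide +kernel)
    g hg M d hd i hi

theorem digitMean_cube : digitMean 10 (fun d => d ^ 3) = 2025 / 10 := by
  norm_num [digitMean, Finset.sum_range_succ]

theorem digitVar_cube : digitVar 10 (fun d => d ^ 3) = 5683425 / 100 := by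
  rw [digitVar, digitMean_cube]
  norm_num [Finset.sum_range_succ]

theorem transferError_cube_lt {n : ℕ} (hn : 43 ≤ n) :
    transferError 10 (fun d => d ^ 3) (10 ^ 13 : ℕ) n < 1 / 10 ^ 11 * ((10 : ℕ) : ℝ) ^ n := by
  have h43 : transferError 10 (fun d => d ^ 3) (10 ^ 13 : ℕ) 43 <
      1 / 10 ^ 11 * ((10 : ℕ) : ℝ) ^ 43 := by
    have hs : √((10 : ℕ) : ℝ) ^ 43 ≤ 4 ^ 43 := by
      gcongr
      rw [Real.sqrt_le_left (by norm_num)]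
      norm_num
    rw [transferError, digitMean_cube, digitVar_cube]
    norm_num at hs ⊢
    linarith
  have := transferError_lt_of_le (by norm_num) (by norm_num) (Nat.cast_nonneg _)
    (by rw [digitMean_cube]; norm_num) h43 0 n (by omega)
  simpa using this

/-- The density bounds for one of the cycles of `cubeMap`, from finite computations. The densities in
`[0, 10 ^ n)` and `[0, 10 ^ n')` are required to exceed the bounds by `10 ^ (-10)`, to make up for the
loss `2 * 10 ^ (-11)` in passing to larger powers of ten. -/
theorem cube_density_bounds {C : Set ℕ} {L : List ℕ} (hL : L ∈ cubeCycles)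
    (hC : C = {x | x ∈ L}) {n n' c c' num num' : ℕ} {u l : ℝ} (hn43 : 43 ≤ n) (hn43' : 43 ≤ n')
    (hn : certifies 10 (fun d => d ^ 3) cubeWindow L n c (1000 * num + 1) (10 ^ 10) = true)
    (hn' : certifies 10 (fun d => d ^ 3) cubeWindow (cubeCycles.filter (· ≠ L)).flatten n' c'
      (10 ^ 10 - 1000 * num' + 1) (10 ^ 10) = true)
    (hu : u = num / 10 ^ 7) (hl : l = num' / 10 ^ 7) (hlu : num' ≤ num) (hnum : num' ≤ 10 ^ 7) :
    u < upperDensity (typeSet cubeMap C) ∧ lowerDensity (typeSet cubeMap C) < l ∧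
      ¬ ∃ d : ℝ, HasDensity (typeSet cubeMap C) d := by
  have key : ∀ L ∈ cubeCycles, (∀ x ∈ L, 0 < x) ∧ (∀ x ∈ L, fastMap 10 (fun d => d ^ 3) 10 x ∈ L) ∧
      (∀ x ∈ (cubeCycles.filter (· ≠ L)).flatten,
        fastMap 10 (fun d => d ^ 3) 10 x ∈ (cubeCycles.filter (· ≠ L)).flatten) ∧
      (∀ x ∈ (cubeCycles.filter (· ≠ L)).flatten, x ∉ L) := by
    decide +kernel
  obtain ⟨k1, k2, k3, k4⟩ := key L hL
  refine density_bounds (h := fun d => d ^ 3) (V := 10 ^ 13) (ε := 1 / 10 ^ 11) (by norm_num)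
    (by norm_num) (fun d hd _ => by positivity) (by rw [digitMean_cube]; norm_num) visits_cube_le
    (fun x => by rw [hC]; rfl) k1 k2 k3 k4 (by norm_num) hn hn' (transferError_cube_lt hn43)
    (transferError_cube_lt hn43') ?_ ?_ ?_
  · rw [hu]
    push_cast
    linarith
  · rw [hl]
    rw [Nat.cast_add, Nat.cast_sub (by omega)]
    push_cast
    linarith
  · rw [hl, hu]
    gcongr

/-- `cubeMap n` is congruent to `n` modulo `3`, since `d ^ 3` is congruent to `d` and `10` to `1`. -/
theorem typeSet_cubeMap_153 : typeSet cubeMap {153} = {n | 0 < n ∧ 3 ∣ n} := by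
  have hmod : ∀ k n, cubeMap^[k] n ≡ n [MOD 3] := by
    have h1 : ∀ n, cubeMap n ≡ n [MOD 3] := by
      intro n
      induction n using Nat.strong_induction_on with
      | _ n ih =>
        rcases Nat.eq_zero_or_pos n with rfl | hn
        · exact congrArg (· % 3) (happyMap_zero _ _)
        · have h1 : cubeMap n = (n % 10) ^ 3 + cubeMap (n / 10) :=
            happyMap_eq (by norm_num) (by norm_num) n
          have h2 := ih (n / 10) (by omega)
          have h3 : ∀ d < 10, d ^ 3 % 3 = d % 3 := by decide
          have h4 := h3 (n % 10) (Nat.mod_lt _ (by norm_num))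
          rw [Nat.ModEq] at h2 ⊢
          omega
    intro k n
    induction k generalizing n with
    | zero => rfl
    | succ k ih => exact (ih _).trans (h1 n)
  ext n
  constructor
  · rintro ⟨hn, k, hk⟩
    refine ⟨hn, ?_⟩
    have := hmod k n
    rw [Set.mem_singleton_iff.1 hk, Nat.ModEq] at this
    omega
  · rintro ⟨hn, hdvd⟩
    refine ⟨hn, ?_⟩
    obtain ⟨k, l, hl, hk⟩ := exists_iterate_cubeMap_mem hn
    refine ⟨k, ?_⟩
    -- `153` is the only one of the first entries that is divisible by `3`
    have key : ∀ l ∈ cubeCycles, l.headI % 3 = 0 → l.headI = 153 := by decide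
    have h3 := hmod k n
    rw [Nat.ModEq, hk] at h3
    rw [hk]
    exact key l hl (by omega)

theorem hasDensity_typeSet_cubeMap_153 : HasDensity (typeSet cubeMap {153}) (1 / 3) := by
  have h1 : ∀ N : ℕ, relDensity (typeSet cubeMap {153}) N = ⌊(1 / 3 : ℝ) * N⌋₊ / (N : ℝ) := by
    intro N
    have e : {n | 0 < n ∧ 3 ∣ n} ∩ Set.Icc 1 N = ({n ∈ Ioc 0 N | 3 ∣ n} : Finset ℕ) := by
      ext n
      simp
      omega
    rw [relDensity, typeSet_cubeMap_153, e, Set.ncard_coe_finset, Nat.Ioc_filter_dvd_card_eq_div,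
      ← Nat.floor_div_eq_div (K := ℝ)]
    congr 3
    push_cast
    ring
  unfold HasDensity
  simp only [funext h1]
  exact (tendsto_nat_floor_mul_div_atTop (by norm_num)).comp tendsto_natCast_atTop_atTop

end Cubes

/-! ### The example in base seven -/

section BaseSeven

/-- The digit sequence of `baseSevenMap`. -/
abbrev sevenDigit (d : ℕ) : ℕ := [0, 1, 7, 4, 17, 9, 13].getD d 0

theorem sevenDigit_pos {d : ℕ} (hd : 0 < d) (hd' : d < 7) : 0 < sevenDigit d := by
  interval_cases d <;> decide

theorem sevenDigit_le {d : ℕ} (hd : d < 7) : sevenDigit d ≤ 17 := by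
  interval_cases d <;> decide

theorem baseSevenMap_eq_fastMap : baseSevenMap = fastMap 7 sevenDigit 10 :=
  funext fun n => (fastMap_eq (by norm_num) rfl 10 n).symm

theorem baseSevenMap_le (n : ℕ) : baseSevenMap n ≤ n / 2 + 40 := by
  induction n using Nat.strong_induction_on with
  | _ n ih =>
    rcases lt_or_ge n 60 with hn | hn
    · have key : (List.range 60).all (fun n =>
          Nat.ble (fastMap 7 sevenDigit 10 n) (n / 2 + 40)) = true := by decide +kernel
      have := List.all_eq_true.1 key n (List.mem_range.2 hn)
      rw [baseSevenMap_eq_fastMap]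
      exact Nat.le_of_ble_eq_true this
    · have h1 : baseSevenMap n = sevenDigit (n % 7) + baseSevenMap (n / 7) :=
        happyMap_eq (by norm_num) rfl n
      have h2 := ih (n / 7) (by omega)
      have h3 := sevenDigit_le (Nat.mod_lt n (by norm_num : 7 > 0))
      omega

theorem cycles_baseSevenMap : cycles baseSevenMap = {{1}, {20}} := by
  rw [cycles_eq (L := [[1], [20]]) (by rw [baseSevenMap_eq_fastMap]; decide +kernel)]
  · ext C
    simp [Set.ext_iff]
  · intro n hn
    refine exists_iterate_mem (H := baseSevenMap) (P := fun x => ∃ l ∈ [[1], [20]], x = l.headI)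
      (B := 81) (fun n hn => ?_) (fun n => happyMap_pos (by norm_num) rfl fun d => sevenDigit_pos)
      (fun n hn hlt => ?_) hn
    · have := baseSevenMap_le n
      omega
    · have key : (List.range 81).all (fun n => Nat.beq n 0 ||
          meets 7 sevenDigit [1, 20] 20 n) = true := by decide +kernel
      have := List.all_eq_true.1 key n (List.mem_range.2 hlt)
      rw [Bool.or_eq_true, Nat.beq_eq] at this
      obtain ⟨k, hk⟩ := exists_iterate_mem_of_meets (by norm_num) rfl (this.resolve_left hn.ne')
      have hk' : baseSevenMap^[k] n ∈ [1, 20] := hk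
      exact ⟨k, by simpa using hk'⟩

theorem digitMean_seven : digitMean 7 sevenDigit = 51 / 7 := by
  norm_num [digitMean, Finset.sum_range_succ]

theorem digitVar_seven : digitVar 7 sevenDigit = 1634 / 49 := by
  rw [digitVar, digitMean_seven]
  norm_num [Finset.sum_range_succ]

theorem transferError_seven_lt {n : ℕ} (hn : 10 ≤ n) :
    transferError 7 sevenDigit (2800 : ℕ) n < 1 / 2000 * ((7 : ℕ) : ℝ) ^ n := by
  have h10 : transferError 7 sevenDigit (2800 : ℕ) 10 < 1 / 2000 * ((7 : ℕ) : ℝ) ^ 10 := by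
    have hs : √((7 : ℕ) : ℝ) ^ 10 = 7 ^ 5 := by
      rw [show 10 = 2 * 5 by norm_num, pow_mul, Real.sq_sqrt (by norm_num)]
      norm_num
    rw [transferError, digitMean_seven, digitVar_seven, hs]
    norm_num
  have := transferError_lt_of_le (by norm_num) rfl (Nat.cast_nonneg _)
    (by rw [digitMean_seven]; norm_num) h10 0 n (by omega)
  simpa using this

/-- The proportions of the two type sets in `[0, 7 ^ 10)` and `[0, 7 ^ 19)` are about `0.98722` and
`0.06313`; the loss in passing to larger powers is at most `2 / 2000`. -/
theorem seven_density_bounds :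
    0.9858 < upperDensity (typeSet baseSevenMap {1}) ∧
      lowerDensity (typeSet baseSevenMap {1}) < 0.94222 ∧
      ¬ ∃ d : ℝ, HasDensity (typeSet baseSevenMap {1}) d :=
  density_bounds (h := sevenDigit) (V := 2800) (L := [1]) (L' := [20]) (win := fun n => (0, 17 * n + 1))
    (n := 10) (n' := 19) (c := 1) (c' := 1) (num := 9872) (num' := 631) (den := 10 ^ 4)
    (ε := 1 / 2000) (by norm_num) rfl (fun d => sevenDigit_pos)
    (by rw [digitMean_seven]; norm_num)
    (visits_le_of_checkMeetingCost (by norm_num) rfl (f := 4) (K := 17) (fun d => sevenDigit_le)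
      (by decide +kernel))
    (by simp) (by decide) (by decide +kernel) (by decide +kernel) (by decide) (by norm_num)
    (by decide +kernel) (by decide +kernel) (transferError_seven_lt (by norm_num))
    (transferError_seven_lt (by norm_num)) (by norm_num) (by norm_num) (by norm_num)

end BaseSeven

end HappyNumbers

theorem mainTheorem3 :
    -- the nine cycles for cubes of decimal digits
    HappyNumbers.cycles HappyNumbers.cubeMap =
      {{1}, {55, 250, 133}, {136, 244}, {153}, {160, 217, 352}, {370}, {371}, {407},
        {919, 1459}} ∧
    -- cycle, lower bound on the upper density, upper bound on the lower density
    (∀ (C : Set ℕ) (u l : ℝ),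
      (C, u, l) ∈
        ([({1}, 0.028219, 0.0049761),
          ({55, 250, 133}, 0.06029, 0.0447701),
          ({136, 244}, 0.024909, 0.006398),
          ({160, 217, 352}, 0.050917, 0.03184),
          ({370}, 0.19905, 0.16065),
          ({371}, 0.30189, 0.288001),
          ({407}, 0.04532, 0.0314401),
          ({919, 1459}, 0.04425, 0.01843)] : List (Set ℕ × ℝ × ℝ)) →
      u < HappyNumbers.upperDensity (HappyNumbers.typeSet HappyNumbers.cubeMap C) ∧
      HappyNumbers.lowerDensity (HappyNumbers.typeSet HappyNumbers.cubeMap C) < l ∧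
      ¬ ∃ d : ℝ, HappyNumbers.HasDensity (HappyNumbers.typeSet HappyNumbers.cubeMap C) d) ∧
    -- the cycle `{153}`
    (HappyNumbers.upperDensity (HappyNumbers.typeSet HappyNumbers.cubeMap {153}) = 1 / 3 ∧
      HappyNumbers.lowerDensity (HappyNumbers.typeSet HappyNumbers.cubeMap {153}) = 1 / 3 ∧
      HappyNumbers.HasDensity (HappyNumbers.typeSet HappyNumbers.cubeMap {153}) (1 / 3)) ∧
    -- the example in base 7
    HappyNumbers.cycles HappyNumbers.baseSevenMap = {{1}, {20}} ∧
    (0.9858 < HappyNumbers.upperDensity (HappyNumbers.typeSet HappyNumbers.baseSevenMap {1}) ∧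
      HappyNumbers.lowerDensity (HappyNumbers.typeSet HappyNumbers.baseSevenMap {1}) < 0.94222 ∧
      ¬ ∃ d : ℝ,
        HappyNumbers.HasDensity (HappyNumbers.typeSet HappyNumbers.baseSevenMap {1}) d) := by
  refine ⟨HappyNumbers.cycles_cubeMap, ?_, ?_, HappyNumbers.cycles_baseSevenMap,
    HappyNumbers.seven_density_bounds⟩
  · intro C u l hmem
    simp only [List.mem_cons, Prod.mk.injEq, List.not_mem_nil, or_false] at hmem
    -- In each case `n` and `n'` are such that the proportion of the type set is near a peak in
    -- `[0, 10 ^ n)`, and near a trough in `[0, 10 ^ n')`.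
    rcases hmem with ⟨rfl, rfl, rfl⟩ | ⟨rfl, rfl, rfl⟩ | ⟨rfl, rfl, rfl⟩ | ⟨rfl, rfl, rfl⟩ |
      ⟨rfl, rfl, rfl⟩ | ⟨rfl, rfl, rfl⟩ | ⟨rfl, rfl, rfl⟩ | ⟨rfl, rfl, rfl⟩
    · exact HappyNumbers.cube_density_bounds (L := [1]) (n := 866) (n' := 131) (c := 94)
        (c' := 43) (num := 282190) (num' := 49761) (by decide) (by ext; simp) (by norm_num)
        (by norm_num) (by decide +kernel) (by decide +kernel) (by norm_num) (by norm_num)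
        (by norm_num) (by norm_num)
    · exact HappyNumbers.cube_density_bounds (L := [55, 250, 133]) (n := 209) (n' := 963) (c := 49)
        (c' := 100) (num := 602900) (num' := 447701) (by decide) (by ext; simp) (by norm_num)
        (by norm_num) (by decide +kernel) (by decide +kernel) (by norm_num) (by norm_num)
        (by norm_num) (by norm_num)
    · exact HappyNumbers.cube_density_bounds (L := [136, 244]) (n := 206) (n' := 2739) (c := 49)
        (c' := 166) (num := 249090) (num' := 63980) (by decide) (by ext; simp) (by norm_num)
        (by norm_num) (by decide +kernel) (by decide +kernel) (by norm_num) (by norm_num)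
        (by norm_num) (by norm_num)
    · exact HappyNumbers.cube_density_bounds (L := [160, 217, 352]) (n := 161) (n' := 456) (c := 46)
        (c' := 73) (num := 509170) (num' := 318400) (by decide) (by ext; simp) (by norm_num)
        (by norm_num) (by decide +kernel) (by decide +kernel) (by norm_num) (by norm_num)
        (by norm_num) (by norm_num)
    · exact HappyNumbers.cube_density_bounds (L := [370]) (n := 278) (n' := 560) (c := 55)
        (c' := 79) (num := 1990500) (num' := 1606500) (by decide) (by ext; simp) (by norm_num)
        (by norm_num) (by decide +kernel) (by decide +kernel) (by norm_num) (by norm_num)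
        (by norm_num) (by norm_num)
    · exact HappyNumbers.cube_density_bounds (L := [371]) (n := 837) (n' := 43) (c := 94)
        (c' := 25) (num := 3018900) (num' := 2880010) (by decide) (by ext; simp) (by norm_num)
        (by norm_num) (by decide +kernel) (by decide +kernel) (by norm_num) (by norm_num)
        (by norm_num) (by norm_num)
    · exact HappyNumbers.cube_density_bounds (L := [407]) (n := 43) (n' := 837) (c := 25)
        (c' := 94) (num := 453200) (num' := 314401) (by decide) (by ext; simp) (by norm_num)
        (by norm_num) (by decide +kernel) (by decide +kernel) (by norm_num) (by norm_num)
        (by norm_num) (by norm_num)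
    · exact HappyNumbers.cube_density_bounds (L := [919, 1459]) (n := 52) (n' := 120) (c := 28)
        (c' := 40) (num := 442500) (num' := 184300) (by decide) (by ext; simp) (by norm_num)
        (by norm_num) (by decide +kernel) (by decide +kernel) (by norm_num) (by norm_num)
        (by norm_num) (by norm_num)
  · have h := HappyNumbers.hasDensity_typeSet_cubeMap_153
    exact ⟨HappyNumbers.upperDensity_eq_of_hasDensity h,
      HappyNumbers.lowerDensity_eq_of_hasDensity h, h⟩
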